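/- **Lemma (exponential stability of the optimal state system).** Let $n_x,n_u\ge 0$, $T>0$, and let $A(t)\in\mathbb R^{n_x\times n_x}$, $B(t)\in\mathbb R^{n_x\times n_u}$, $Q(t)\in\mathbb R^{n_x\times n_x}$, $H(t)\in\mathbb R^{n_u\times n_x}$, $R(t)\in\mathbb R^{n_u\times n_u}$ $(t\in[0,T])$ be matrix functions and $Q_T\in\mathbb R^{n_x\times n_x}$ a matrix, with $Q(t)$, $R(t)$, $Q_T$ symmetric. $\|\cdot\|$ is the Euclidean operator norm, $\preceq$ is the Loewner order of symmetric matrices, and for continuous $M:[0,T]\to\mathbb R^{n\times n}$, $\Phi_M(t,s)$ $(s,t\in[0,T])$ is the evolution operator of $\dot x=M(t)x$, that is, $\partial_t\Phi_M(t,s)=M(t)\Phi_M(t,s)$, $\Phi_M(s,s)=I$. Suppose that: 1. $A,B,Q,H,R$ are continuous on $[0,T]$, with $\|A(t)\|\le\lambda_A$, $\|B(t)\|\le\lambda_B$, $\|Q(t)\|\le\lambda_Q$, $\|H(t)\|\le\lambda_H$, $\|R(t)\|\le\lambda_R$ for all $t\in[0,T]$, where $\lambda_A,\lambda_B,\lambda_Q,\lambda_H,\lambda_R>0$.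 2. (Uniform complete controllability.) There are $\sigma\in(0,T)$ and $\alpha_0,\alpha_1,\beta_0,\beta_1>0$ such that for every $t_0\in[0,T-\sigma]$ there is $t_1\in[t_0,t_0+\sigma]$ with $$\alpha_0I\preceq W(t_0,t_1)\preceq\alpha_1I,\qquad \beta_0I\preceq\Phi_A(t_1,t_0)W(t_0,t_1)\Phi_A(t_1,t_0)^\top\preceq\beta_1I,$$ where $W(t_0,t_1)=\int_{t_0}^{t_1}\Phi_A(t_0,s)B(s)B(s)^\top\Phi_A(t_0,s)^\top\,ds$. 3. There are $\gamma_R>0$ and $0<\gamma_Q\le\lambda_Q$ with $R(t)\succeq\gamma_RI$ and $Q(t)-H(t)^\top R(t)^{-1}H(t)\succeq\gamma_QI$ for all $t\in[0,T]$, and $\gamma_QI\preceq Q_T\preceq\lambda_QI$. Then the Riccati terminal value problem $$\dot S=SBR^{-1}B^\top S-S(A-BR^{-1}H)-(A-BR^{-1}H)^\top S-(Q-H^\top R^{-1}H)\ \text{ on }[0,T],\qquad S(T)=Q_T,$$ has a unique solution $S:[0,T]\to\mathbb R^{n_x\times n_x}$, and the closed-loop matrix $$Z(t)=A(t)-B(t)R(t)^{-1}H(t)-B(t)R(t)^{-1}B(t)^\top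 S(t)$$ satisfies $$\|\Phi_Z(t_1,t_0)\|\le\sqrt{\frac{c_1}{c_0}}\;\exp\Big(-\frac{\gamma_Q}{2c_1}(t_1-t_0)\Big)\qquad\text{for all }0\le t_0\le t_1\le T,$$ where the constants $c_0,c_1$ do not depend on $T$ and are given, with $\omega=\lambda_A+\lambda_B\lambda_H/\gamma_R$ and $$\tilde\alpha_0=\frac{1-e^{-2\omega\sigma}}{2\omega},\quad \tilde\alpha_1=\frac{e^{2\omega\sigma}-1}{2\omega},\quad \alpha_1'=\frac{\lambda_B^2(e^{2\sigma\omega}-1)}{2\omega},\quad \alpha_0'=\Big(\frac2{\alpha_0}+\frac{\lambda_H^2}{\gamma_R^2\lambda_A}\Big(1+\frac{\alpha_1}{\alpha_0}\Big)^2\big(e^{2\lambda_A\sigma}-1\big)\Big)^{-1},$$ by $$c_0=\min\Big\{2\omega\Big(\frac{\lambda_B^2}{\gamma_R}\Big(1+\frac{\tilde\alpha_1}{\tilde\alpha_0}\Big)^2+\frac1{\gamma_Q\tilde\alpha_0^2}\Big)^{-1},\ \Big(\frac{\lambda_B^2}{2\gamma_R\omega}+\frac1{\gamma_Q}\Big)^{-1}\Big\}e^{-2\omega\sigma},$$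 $$c_1=\max\Big\{\Big(\Big(\lambda_Q+\frac{\lambda_H^2}{\gamma_R}\Big)\Big(1+\frac{\alpha_1'}{\alpha_0'}\Big)^2+\frac{\lambda_R\lambda_B^2}{(\alpha_0')^2}\Big)\frac1{2\omega},\ \Big(\lambda_Q+\frac{\lambda_H^2}{\gamma_R}\Big)\Big(1+\frac1{2\omega}\Big)\Big\}e^{2\omega\sigma}.$$ -/

import Mathlib

open scoped Matrix
-- `‖M‖` is the operator norm of the matrix `M` with respect to the Euclidean norms.
open scoped Matrix.Norms.L2Operator
-- `M ≤ N` is the Loewner order on matrices: `N - M` is symmetric positive semidefinite.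
open scoped MatrixOrder

namespace LQControl

/-! ### The evolution operator of a linear system -/

/-- The terms of the Peano-Baker series of `ẋ(t) = A(t) x(t)`: the zeroth one is the identity and
the `(k+1)`-st one is `∫ τ in s..t, A(τ) Pₖ(τ, s)`. -/
noncomputable def peanoBaker {n : ℕ} (A : ℝ → Matrix (Fin n) (Fin n) ℝ) :
    ℕ → ℝ → ℝ → Matrix (Fin n) (Fin n) ℝ
  | 0, _, _ => 1
  | k + 1, t, s => ∫ τ in s..t, A τ * peanoBaker A k τ s

/-- The evolution operator `Φ_A(t, s)` of the system `ẋ(t) = A(t) x(t)`, as the sum of the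
Peano-Baker series. Below it is shown that `t ↦ Φ_A(t, s)` is a solution of `Ẋ = A X`, `X(s) = I`,
and that `x(t) = Φ_A(t, s) x(s)` for each solution `x` of `ẋ = A x`. -/
noncomputable def evolutionOperator {n : ℕ} (A : ℝ → Matrix (Fin n) (Fin n) ℝ) (t s : ℝ) :
    Matrix (Fin n) (Fin n) ℝ :=
  ∑' k, peanoBaker A k t s

section Evolution

variable {n : ℕ}

theorem evolutionOperator_self (A : ℝ → Matrix (Fin n) (Fin n) ℝ) (s : ℝ) :
    evolutionOperator A s s = 1 := by
  unfold evolutionOperator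
  rw [tsum_eq_single 0]
  · rfl
  · intro k hk
    obtain ⟨k, rfl⟩ := Nat.exists_eq_succ_of_ne_zero hk
    simp [peanoBaker]

theorem peanoBaker_congr {A A' : ℝ → Matrix (Fin n) (Fin n) ℝ} {a b : ℝ}
    (h : Set.EqOn A A' (Set.Icc a b)) (k : ℕ) :
    ∀ t ∈ Set.Icc a b, ∀ s ∈ Set.Icc a b, peanoBaker A k t s = peanoBaker A' k t s := by
  induction k with
  | zero => intros; rfl
  | succ k ih =>
    intro t ht s hs
    simp only [peanoBaker]
    apply intervalIntegral.integral_congr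
    intro τ hτ
    have hτ' : τ ∈ Set.Icc a b := Set.uIcc_subset_Icc hs ht hτ
    simp only [h hτ', ih τ hτ' s hs]

theorem peanoBaker_continuous {A : ℝ → Matrix (Fin n) (Fin n) ℝ} (hA : Continuous A) (s : ℝ)
    (k : ℕ) : Continuous fun t => peanoBaker A k t s := by
  induction k with
  | zero => exact continuous_const
  | succ k ih =>
    have := fun t => ((hA.mul ih).integral_hasStrictDerivAt s t).hasDerivAt
    exact continuous_iff_continuousAt.2 fun t => (this t).continuousAt

theorem peanoBaker_hasDerivAt {A : ℝ → Matrix (Fin n) (Fin n) ℝ} (hA : Continuous A) (s t : ℝ)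
    (k : ℕ) : HasDerivAt (fun t => peanoBaker A (k + 1) t s) (A t * peanoBaker A k t s) t :=
  ((hA.mul (peanoBaker_continuous hA s k)).integral_hasStrictDerivAt s t).hasDerivAt

theorem peanoBaker_norm_le {A : ℝ → Matrix (Fin n) (Fin n) ℝ} {M : ℝ} (hM : ∀ t, ‖A t‖ ≤ M)
    (s : ℝ) (k : ℕ) : ∀ t, ‖peanoBaker A k t s‖ ≤
      ‖(1 : Matrix (Fin n) (Fin n) ℝ)‖ * (M ^ k * |t - s| ^ k / k.factorial) := by
  have hM0 : 0 ≤ M := (norm_nonneg _).trans (hM 0)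
  induction k with
  | zero => intro t; simp [peanoBaker]
  | succ k ih =>
    intro t
    simp only [peanoBaker]
    set c := ‖(1 : Matrix (Fin n) (Fin n) ℝ)‖
    refine (intervalIntegral.norm_integral_le_abs_of_norm_le
      (g := fun τ => (c * M ^ (k + 1) / k.factorial) * |τ - s| ^ k) ?_ ?_).trans ?_
    · refine Filter.Eventually.of_forall fun τ => ?_
      calc ‖A τ * peanoBaker A k τ s‖ ≤ ‖A τ‖ * ‖peanoBaker A k τ s‖ := norm_mul_le _ _
        _ ≤ M * (c * (M ^ k * |τ - s| ^ k / k.factorial)) :=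
            mul_le_mul (hM τ) (ih τ) (norm_nonneg _) hM0
        _ = _ := by ring
    · apply Continuous.intervalIntegrable
      fun_prop
    · rw [intervalIntegral.integral_const_mul, abs_mul, intervalIntegral.abs_intervalIntegral_eq,
        integral_pow_abs_sub_uIoc, abs_of_nonneg (a := c * M ^ (k + 1) / k.factorial)
          (by positivity), abs_of_nonneg (by positivity), Nat.factorial_succ]
      push_cast
      apply le_of_eq
      field_simp

theorem evolutionOperator_hasDerivAt {A : ℝ → Matrix (Fin n) (Fin n) ℝ} (hA : Continuous A)
    {M : ℝ} (hM : ∀ t, ‖A t‖ ≤ M) (s t : ℝ) :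
    HasDerivAt (fun t => evolutionOperator A t s) (A t * evolutionOperator A t s) t := by
  have hM0 : 0 ≤ M := (norm_nonneg _).trans (hM 0)
  set c := ‖(1 : Matrix (Fin n) (Fin n) ℝ)‖
  set r := |t - s| + 1
  have hsum : ∀ x : ℝ, Summable fun k : ℕ => c * (M ^ k * x ^ k / k.factorial) := fun x => by
    simpa [mul_pow] using (Real.summable_pow_div_factorial (M * x)).mul_left c
  have hP : ∀ u, Summable fun k => peanoBaker A k u s := fun u =>
    Summable.of_norm_bounded (hsum _) fun k => peanoBaker_norm_le hM s k u
  have hsplit : (fun t => evolutionOperator A t s) =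
      fun t => 1 + ∑' k, peanoBaker A (k + 1) t s := by
    funext u
    exact (hP u).tsum_eq_zero_add
  have hmul : A t * evolutionOperator A t s = ∑' k, A t * peanoBaker A k t s :=
    ((hP t).tsum_mul_left (A t)).symm
  rw [hsplit, hmul]
  refine HasDerivAt.const_add 1 ?_
  refine hasDerivAt_tsum_of_isPreconnected
    (u := fun k : ℕ => M * (c * (M ^ k * r ^ k / k.factorial)))
    (t := Metric.ball s r) ((hsum r).mul_left M) Metric.isOpen_ball
    (convex_ball s r).isPreconnected (fun k u _ => peanoBaker_hasDerivAt hA s u k) ?_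
    (y₀ := t) ?_ ((summable_nat_add_iff 1).2 (hP t)) ?_
  · intro k u hu
    have hu' : |u - s| ≤ r := by
      rw [Metric.mem_ball, Real.dist_eq] at hu
      exact hu.le
    refine (norm_mul_le _ _).trans (mul_le_mul (hM u) ((peanoBaker_norm_le hM s k u).trans ?_)
      (norm_nonneg _) hM0)
    gcongr
  all_goals
    rw [Metric.mem_ball, Real.dist_eq]
    exact lt_add_one _

/-- `t ↦ Φ_A(t, s)` solves the matrix differential equation `Ẋ = A X` on `[a, b]`. -/
theorem evolutionOperator_hasDerivWithinAt {A : ℝ → Matrix (Fin n) (Fin n) ℝ} {a b : ℝ}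
    (hA : ContinuousOn A (Set.Icc a b)) {s t : ℝ} (hs : s ∈ Set.Icc a b) (ht : t ∈ Set.Icc a b) :
    HasDerivWithinAt (fun t => evolutionOperator A t s) (A t * evolutionOperator A t s)
      (Set.Icc a b) t := by
  have hab : a ≤ b := hs.1.trans hs.2
  set A' : ℝ → Matrix (Fin n) (Fin n) ℝ := Set.IccExtend hab ((Set.Icc a b).domRestrict A) with hA'
  have hA'c : Continuous A' := (continuousOn_iff_continuous_domRestrict.1 hA).Icc_extend'
  have heq : Set.EqOn A A' (Set.Icc a b) := fun τ hτ => by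
    rw [hA', Set.IccExtend_of_mem hab _ hτ]; rfl
  obtain ⟨M, hM⟩ := isCompact_Icc.exists_bound_of_continuousOn hA
  have hM' : ∀ τ, ‖A' τ‖ ≤ M := fun τ => by
    exact hM _ (Set.projIcc a b hab τ).2
  have hΦ : ∀ u ∈ Set.Icc a b, evolutionOperator A u s = evolutionOperator A' u s := fun u hu =>
    tsum_congr fun k => peanoBaker_congr heq k u hu s hs
  rw [heq ht, hΦ t ht]
  exact (evolutionOperator_hasDerivAt hA'c hM' s t).hasDerivWithinAt.congr hΦ (hΦ t ht)

/-- Each solution of `ẋ = A x` on `[a, b]` satisfies `x(t) = Φ_A(t, s) x(s)`. -/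
theorem eq_evolutionOperator_mulVec {A : ℝ → Matrix (Fin n) (Fin n) ℝ} {a b : ℝ}
    (hA : ContinuousOn A (Set.Icc a b)) {x : ℝ → Fin n → ℝ}
    (hx : ∀ t ∈ Set.Icc a b, HasDerivWithinAt x (A t *ᵥ x t) (Set.Icc a b) t)
    {s t : ℝ} (hs : s ∈ Set.Icc a b) (ht : t ∈ Set.Icc a b) :
    x t = evolutionOperator A t s *ᵥ x s := by
  set L : Matrix (Fin n) (Fin n) ℝ →ₗ[ℝ] (Fin n → ℝ) →L[ℝ] (Fin n → ℝ) :=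
    { toFun := fun M => LinearMap.toContinuousLinearMap (Matrix.mulVecLin M)
      map_add' := fun M N => by ext; simp
      map_smul' := fun c M => by ext; simp } with hL
  have hLA : ContinuousOn (fun τ => L (A τ)) (Set.Icc a b) :=
    (LinearMap.continuous_of_finiteDimensional L).comp_continuousOn hA
  obtain ⟨K, hK⟩ := isCompact_Icc.exists_bound_of_continuousOn hLA
  have hv : ∀ τ ∈ Set.Icc a b,
      LipschitzOnWith K.toNNReal (fun y : Fin n → ℝ => A τ *ᵥ y) Set.univ := fun τ hτ => by
    refine ((L (A τ)).lipschitz.weaken ?_).lipschitzOnWith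
    exact NNReal.coe_le_coe.1 ((hK τ hτ).trans (Real.le_coe_toNNReal K))
  set y : ℝ → Fin n → ℝ := fun τ => evolutionOperator A τ s *ᵥ x s with hy
  have hyd : ∀ τ ∈ Set.Icc a b, HasDerivWithinAt y (A τ *ᵥ y τ) (Set.Icc a b) τ := by
    intro τ hτ
    let E : Matrix (Fin n) (Fin n) ℝ →L[ℝ] (Fin n → ℝ) :=
      LinearMap.toContinuousLinearMap ((LinearMap.applyₗ (x s)).comp
        (Matrix.toLin' (R := ℝ) (m := Fin n) (n := Fin n)).toLinearMap)
    have hE := E.hasFDerivAt.comp_hasDerivWithinAt τ (evolutionOperator_hasDerivWithinAt hA hs hτ)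
    have h1 : E (A τ * evolutionOperator A τ s) = A τ *ᵥ y τ := by
      simp [E, hy, Matrix.mulVec_mulVec]
    rw [h1] at hE
    exact hE.congr (fun u _ => by simp [E, hy]) (by simp [E, hy])
  have hxs : x s = y s := by simp [hy, evolutionOperator_self]
  rcases le_total s t with hst | hts
  · have hsub : Set.Icc s b ⊆ Set.Icc a b := Set.Icc_subset_Icc_left hs.1
    have key : ∀ z : ℝ → Fin n → ℝ,
        (∀ τ ∈ Set.Icc a b, HasDerivWithinAt z (A τ *ᵥ z τ) (Set.Icc a b) τ) →
        ∀ τ ∈ Set.Ico s b, HasDerivWithinAt z (A τ *ᵥ z τ) (Set.Ici τ) τ := fun z hz τ hτ =>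
      (hz τ (hsub (Set.Ico_subset_Icc_self hτ))).mono_of_mem_nhdsWithin
        (Filter.mem_of_superset (Icc_mem_nhdsGE hτ.2)
          (Set.Icc_subset_Icc_left (hs.1.trans hτ.1)))
    exact ODE_solution_unique_of_mem_Icc_right (s := fun _ => Set.univ)
      (fun τ hτ => hv τ (hsub (Set.Ico_subset_Icc_self hτ)))
      (fun τ hτ => ((hx τ (hsub hτ)).continuousWithinAt).mono hsub) (key x hx)
      (fun _ _ => trivial)
      (fun τ hτ => ((hyd τ (hsub hτ)).continuousWithinAt).mono hsub) (key y hyd)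
      (fun _ _ => trivial) hxs ⟨hst, ht.2⟩
  · have hsub : Set.Icc a s ⊆ Set.Icc a b := Set.Icc_subset_Icc_right hs.2
    have key : ∀ z : ℝ → Fin n → ℝ,
        (∀ τ ∈ Set.Icc a b, HasDerivWithinAt z (A τ *ᵥ z τ) (Set.Icc a b) τ) →
        ∀ τ ∈ Set.Ioc a s, HasDerivWithinAt z (A τ *ᵥ z τ) (Set.Iic τ) τ := fun z hz τ hτ =>
      (hz τ (hsub (Set.Ioc_subset_Icc_self hτ))).mono_of_mem_nhdsWithin
        (Filter.mem_of_superset (Icc_mem_nhdsLE hτ.1)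
          (Set.Icc_subset_Icc_right (hτ.2.trans hs.2)))
    exact ODE_solution_unique_of_mem_Icc_left (s := fun _ => Set.univ)
      (fun τ hτ => hv τ (hsub (Set.Ioc_subset_Icc_self hτ)))
      (fun τ hτ => ((hx τ (hsub hτ)).continuousWithinAt).mono hsub) (key x hx)
      (fun _ _ => trivial)
      (fun τ hτ => ((hyd τ (hsub hτ)).continuousWithinAt).mono hsub) (key y hyd)
      (fun _ _ => trivial) hxs ⟨ht.1, hts⟩

end Evolution

/-- The controllability Gramian
`W_{A,B}(t₀, t₁) = ∫ s in t₀..t₁, Φ_A(t₀, s) B(s) B(s)ᵀ Φ_A(t₀, s)ᵀ`. -/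
noncomputable def gramian {nx nu : ℕ} (A : ℝ → Matrix (Fin nx) (Fin nx) ℝ)
    (B : ℝ → Matrix (Fin nx) (Fin nu) ℝ) (t₀ t₁ : ℝ) : Matrix (Fin nx) (Fin nx) ℝ :=
  ∫ s in t₀..t₁, evolutionOperator A t₀ s * B s * (B s)ᵀ * (evolutionOperator A t₀ s)ᵀ

/-! ### The data and the assumptions -/

/-- The data of a linear-quadratic optimal control problem on `[0, T]`: dynamics
`ẋ = A x + B u`, running cost `½ (xᵀ Q x + 2 uᵀ H x + uᵀ R u)`, terminal cost `½ x(T)ᵀ Q_T x(T)`.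
Only the values of the coefficients on `[0, T]` matter. -/
structure Problem (nx nu : ℕ) where
  T : ℝ
  A : ℝ → Matrix (Fin nx) (Fin nx) ℝ
  B : ℝ → Matrix (Fin nx) (Fin nu) ℝ
  Q : ℝ → Matrix (Fin nx) (Fin nx) ℝ
  H : ℝ → Matrix (Fin nu) (Fin nx) ℝ
  R : ℝ → Matrix (Fin nu) (Fin nu) ℝ
  QT : Matrix (Fin nx) (Fin nx) ℝ

/-- The constants of the assumptions; they involve neither the horizon `T` nor the data. -/
structure Constants where
  lamA : ℝ
  lamB : ℝ
  lamQ : ℝ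
  lamH : ℝ
  lamR : ℝ
  γR : ℝ
  γQ : ℝ
  σ : ℝ
  α₀ : ℝ
  α₁ : ℝ
  β₀ : ℝ
  β₁ : ℝ

namespace Problem

variable {nx nu : ℕ} (P : Problem nx nu) (k : Constants)

/-- Continuity and uniform boundedness of the coefficients. -/
structure IsBounded : Prop where
  lamA_pos : 0 < k.lamA
  lamB_pos : 0 < k.lamB
  lamQ_pos : 0 < k.lamQ
  lamH_pos : 0 < k.lamH
  lamR_pos : 0 < k.lamR
  continuousOn_A : ContinuousOn P.A (Set.Icc 0 P.T)
  continuousOn_B : ContinuousOn P.B (Set.Icc 0 P.T)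
  continuousOn_Q : ContinuousOn P.Q (Set.Icc 0 P.T)
  continuousOn_H : ContinuousOn P.H (Set.Icc 0 P.T)
  continuousOn_R : ContinuousOn P.R (Set.Icc 0 P.T)
  norm_A_le : ∀ t ∈ Set.Icc 0 P.T, ‖P.A t‖ ≤ k.lamA
  norm_B_le : ∀ t ∈ Set.Icc 0 P.T, ‖P.B t‖ ≤ k.lamB
  norm_Q_le : ∀ t ∈ Set.Icc 0 P.T, ‖P.Q t‖ ≤ k.lamQ
  norm_H_le : ∀ t ∈ Set.Icc 0 P.T, ‖P.H t‖ ≤ k.lamH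
  norm_R_le : ∀ t ∈ Set.Icc 0 P.T, ‖P.R t‖ ≤ k.lamR

/-- Uniform complete controllability of the pair `(A, B)`. -/
structure IsUCC : Prop where
  σ_pos : 0 < k.σ
  σ_lt : k.σ < P.T
  α₀_pos : 0 < k.α₀
  α₁_pos : 0 < k.α₁
  β₀_pos : 0 < k.β₀
  β₁_pos : 0 < k.β₁
  bounds : ∀ t₀ ∈ Set.Icc 0 (P.T - k.σ), ∃ t₁ ∈ Set.Icc t₀ (t₀ + k.σ),
    k.α₀ • 1 ≤ gramian P.A P.B t₀ t₁ ∧ gramian P.A P.B t₀ t₁ ≤ k.α₁ • 1 ∧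
    k.β₀ • 1 ≤ evolutionOperator P.A t₁ t₀ * gramian P.A P.B t₀ t₁ *
      (evolutionOperator P.A t₁ t₀)ᵀ ∧
    evolutionOperator P.A t₁ t₀ * gramian P.A P.B t₀ t₁ *
      (evolutionOperator P.A t₁ t₀)ᵀ ≤ k.β₁ • 1

/-- Coercivity of the cost. The weights `Q(t)`, `R(t)`, `Q_T` are symmetric matrices. -/
structure IsCoercive : Prop where
  γR_pos : 0 < k.γR
  γQ_pos : 0 < k.γQ
  γQ_le : k.γQ ≤ k.lamQ
  symm_Q : ∀ t ∈ Set.Icc 0 P.T, (P.Q t).IsSymm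
  symm_R : ∀ t ∈ Set.Icc 0 P.T, (P.R t).IsSymm
  symm_QT : P.QT.IsSymm
  le_R : ∀ t ∈ Set.Icc 0 P.T, k.γR • 1 ≤ P.R t
  le_Q : ∀ t ∈ Set.Icc 0 P.T, k.γQ • 1 ≤ P.Q t - (P.H t)ᵀ * (P.R t)⁻¹ * P.H t
  le_QT : k.γQ • 1 ≤ P.QT
  QT_le : P.QT ≤ k.lamQ • 1

/-! ### The Riccati equation and the closed-loop matrix -/

/-- `S` solves the terminal value problem for the matrix Riccati equation on `[0, T]`
(with one-sided derivatives at the end points). -/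
structure IsRiccatiSolution (S : ℝ → Matrix (Fin nx) (Fin nx) ℝ) : Prop where
  hasDerivWithinAt : ∀ t ∈ Set.Icc 0 P.T, HasDerivWithinAt S
    (S t * P.B t * (P.R t)⁻¹ * (P.B t)ᵀ * S t
      - S t * (P.A t - P.B t * (P.R t)⁻¹ * P.H t)
      - (P.A t - P.B t * (P.R t)⁻¹ * P.H t)ᵀ * S t
      - (P.Q t - (P.H t)ᵀ * (P.R t)⁻¹ * P.H t)) (Set.Icc 0 P.T) t
  terminal : S P.T = P.QT

/-- The closed-loop matrix `Z = A - B R⁻¹ H - B R⁻¹ Bᵀ S`. -/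
noncomputable def closedLoop (S : ℝ → Matrix (Fin nx) (Fin nx) ℝ) (t : ℝ) :
    Matrix (Fin nx) (Fin nx) ℝ :=
  P.A t - P.B t * (P.R t)⁻¹ * P.H t - P.B t * (P.R t)⁻¹ * (P.B t)ᵀ * S t

end Problem

/-! ### The explicit constants -/

namespace Constants

variable (k : Constants)

/-- `ω = λ_A + λ_B λ_H / γ_R`, a bound for `‖A - B R⁻¹ H‖`. -/
noncomputable def ω : ℝ := k.lamA + k.lamB * k.lamH / k.γR

/-- The lower constant `α₀'` for the Gramian of `(A - B R⁻¹ H, B)`. -/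
noncomputable def α₀' : ℝ :=
  (2 / k.α₀ + (k.lamH / k.γR) ^ 2 / k.lamA * (1 + k.α₁ / k.α₀) ^ 2 *
    (Real.exp (2 * k.lamA * k.σ) - 1))⁻¹

/-- The upper constant `α₁'` for the Gramian of `(A - B R⁻¹ H, B)`. -/
noncomputable def α₁' : ℝ :=
  k.lamB ^ 2 * (Real.exp (2 * k.σ * k.ω) - 1) / (2 * k.ω)

/-- The lower constant for the Gramian of the dual pair `(-(A - B R⁻¹ H)ᵀ, I)`. -/
noncomputable def αt₀ : ℝ := 1 / (2 * k.ω) * (1 - Real.exp (-2 * k.ω * k.σ))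

/-- The upper constant for the Gramian of the dual pair `(-(A - B R⁻¹ H)ᵀ, I)`. -/
noncomputable def αt₁ : ℝ := 1 / (2 * k.ω) * (Real.exp (2 * k.ω * k.σ) - 1)

/-- The lower Riccati constant `c₀(σ)`. -/
noncomputable def c₀ : ℝ :=
  min (2 * k.ω * (k.lamB ^ 2 / k.γR * (1 + k.αt₁ / k.αt₀) ^ 2 + 1 / (k.γQ * k.αt₀ ^ 2))⁻¹)
      ((k.lamB ^ 2 / (2 * k.γR * k.ω) + 1 / k.γQ)⁻¹) *
    Real.exp (-2 * k.ω * k.σ)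

/-- The upper Riccati constant `c₁(σ)`. -/
noncomputable def c₁ : ℝ :=
  max (((k.lamQ + k.lamH ^ 2 / k.γR) * (1 + k.α₁' / k.α₀') ^ 2 +
        k.lamR * k.lamB ^ 2 / k.α₀' ^ 2) * (1 / (2 * k.ω)))
      ((k.lamQ + k.lamH ^ 2 / k.γR) * (1 + 1 / (2 * k.ω))) *
    Real.exp (2 * k.ω * k.σ)

end Constants

end LQControl

/-! Substituting `v = u + R⁻¹ H x` removes the cross term: with `F = A - B R⁻¹ H`, `G = B R⁻¹ Bᵀ`
and weight `Q̃ = Q - Hᵀ R⁻¹ H`, the equation becomes `Ṡ = S G S - S F - Fᵀ S - Q̃` and the closed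
loop is `F - G S`. If `c₀ I ≤ S ≤ c₁ I`, then `V = xᵀ S x` is a Lyapunov function: `V' = -(S x)ᵀ G
(S x) - xᵀ Q̃ x ≤ -γ_Q |x|² ≤ -(γ_Q / c₁) V`, which gives the decay estimate
(`SolvesRiccati.closedLoop_norm_le`).

Existence is global because the Riccati flow is a quotient of a linear Hamiltonian flow, `S = Y
X⁻¹`, where definiteness of the data keeps `X` invertible (`exists_solvesRiccati`). Uniqueness, and
through it symmetry of `S`, follows because the difference of two solutions solves a linear
equation.

For the lower bound, `c₀` is so small that `c₀ I` is a subsolution of the Riccati equation lying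
below `Q_T`; a comparison argument then suffices (`SolvesRiccati.le_form`, `IsBounded.c₀_bounds`),
with no Gramian estimate for the dual pair.

For the upper bound, `xᵀ S x` at the initial time is at most the cost of any admissible control.
Within `σ` of the end, take `v = 0`. Earlier, take the minimum energy control of `(A, B)` steering
the state to `0` within time `σ`, so that no terminal cost remains (`exists_steering`,
`IsRiccatiSolution.form_le_c₁`). Only windows of length at most `σ` enter, whence independence of
`T`. -/

namespace LQControl

/-! ### Quadratic forms, Euclidean operator norms and the Loewner order -/

section DotProduct

variable {m n : ℕ}

theorem mulVec_dotProduct_eq (M : Matrix (Fin m) (Fin n) ℝ) (x : Fin n → ℝ) (y : Fin m → ℝ) :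
    (M *ᵥ x) ⬝ᵥ y = x ⬝ᵥ (Mᵀ *ᵥ y) := by
  rw [Matrix.mulVec_transpose, dotProduct_comm, Matrix.dotProduct_mulVec, dotProduct_comm]

theorem dotProduct_self_nonneg' (x : Fin n → ℝ) : 0 ≤ x ⬝ᵥ x :=
  Finset.sum_nonneg fun i _ => mul_self_nonneg (x i)

theorem eq_zero_of_dotProduct_self_nonpos {x : Fin n → ℝ} (h : x ⬝ᵥ x ≤ 0) : x = 0 :=
  dotProduct_self_eq_zero.1 (h.antisymm (dotProduct_self_nonneg' x))

/-- `Fin n → ℝ` carries the sup norm, so Euclidean lengths appear throughout as `x ⬝ᵥ x`; this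
identity is the bridge to the operator norm of matrices. -/
theorem dotProduct_self_eq_norm_sq (x : Fin n → ℝ) : x ⬝ᵥ x = ‖WithLp.toLp 2 x‖ ^ 2 := by
  rw [EuclideanSpace.real_norm_sq_eq]
  exact Finset.sum_congr rfl fun i _ => (sq (x i)).symm

theorem dotProduct_sq_le (x y : Fin n → ℝ) : (x ⬝ᵥ y) ^ 2 ≤ (x ⬝ᵥ x) * (y ⬝ᵥ y) := by
  simpa [dotProduct, sq] using Finset.sum_mul_sq_le_sq_mul_sq Finset.univ x y

theorem two_dotProduct_le (x y : Fin n → ℝ) : 2 * (x ⬝ᵥ y) ≤ x ⬝ᵥ x + y ⬝ᵥ y := by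
  have h := dotProduct_self_nonneg' (x - y)
  simp only [sub_dotProduct, dotProduct_sub, dotProduct_comm y x] at h
  linarith

theorem add_dotProduct_add_le (x y : Fin n → ℝ) :
    (x + y) ⬝ᵥ (x + y) ≤ 2 * (x ⬝ᵥ x) + 2 * (y ⬝ᵥ y) := by
  have h := two_dotProduct_le x y
  simp only [add_dotProduct, dotProduct_add, dotProduct_comm y x]
  linarith

theorem mulVec_dotProduct_self_le {M : Matrix (Fin m) (Fin n) ℝ} {c : ℝ} (h : ‖M‖ ≤ c)
    (x : Fin n → ℝ) : (M *ᵥ x) ⬝ᵥ (M *ᵥ x) ≤ c ^ 2 * (x ⬝ᵥ x) := by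
  rw [dotProduct_self_eq_norm_sq, dotProduct_self_eq_norm_sq, ← mul_pow]
  have := Matrix.l2_opNorm_mulVec M (WithLp.toLp 2 x)
  exact pow_le_pow_left₀ (norm_nonneg _)
    (this.trans (mul_le_mul_of_nonneg_right h (norm_nonneg _))) 2

theorem norm_le_of_mulVec_dotProduct_self_le {M : Matrix (Fin m) (Fin n) ℝ} {c : ℝ} (hc : 0 ≤ c)
    (h : ∀ x : Fin n → ℝ, (M *ᵥ x) ⬝ᵥ (M *ᵥ x) ≤ c ^ 2 * (x ⬝ᵥ x)) : ‖M‖ ≤ c := by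
  rw [Matrix.l2_opNorm_def]
  refine ContinuousLinearMap.opNorm_le_bound _ hc fun x => ?_
  have := h (WithLp.ofLp x)
  rw [dotProduct_self_eq_norm_sq, dotProduct_self_eq_norm_sq, ← mul_pow] at this
  exact le_of_sq_le_sq this (by positivity)

theorem abs_dotProduct_le_of_self_le {x y : Fin n → ℝ} {c r : ℝ} (hc : 0 ≤ c) (hr : x ⬝ᵥ x ≤ r)
    (h : y ⬝ᵥ y ≤ c ^ 2 * r) : |x ⬝ᵥ y| ≤ c * r := by
  have h0 := (dotProduct_self_nonneg' x).trans hr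
  refine abs_le_of_sq_le_sq ?_ (by positivity)
  calc (x ⬝ᵥ y) ^ 2 ≤ (x ⬝ᵥ x) * (y ⬝ᵥ y) := dotProduct_sq_le x y
    _ ≤ r * (c ^ 2 * r) := mul_le_mul hr h (dotProduct_self_nonneg' y) h0
    _ = (c * r) ^ 2 := by ring

theorem abs_dotProduct_mulVec_le {M : Matrix (Fin n) (Fin n) ℝ} {c : ℝ} (h : ‖M‖ ≤ c)
    (x : Fin n → ℝ) : |x ⬝ᵥ (M *ᵥ x)| ≤ c * (x ⬝ᵥ x) :=
  abs_dotProduct_le_of_self_le ((norm_nonneg _).trans h) le_rfl (mulVec_dotProduct_self_le h x)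

/-- The triangle inequality for Euclidean norms, squared. -/
theorem sub_dotProduct_sub_le {x y : Fin n → ℝ} {c r : ℝ} (hc : 0 ≤ c)
    (hr : x ⬝ᵥ x ≤ r) (h : y ⬝ᵥ y ≤ c ^ 2 * r) : (x - y) ⬝ᵥ (x - y) ≤ (1 + c) ^ 2 * r := by
  have := (abs_le.1 (abs_dotProduct_le_of_self_le hc hr h)).1
  simp only [sub_dotProduct, dotProduct_sub, dotProduct_comm y x]
  nlinarith

theorem norm_transpose_eq (M : Matrix (Fin m) (Fin n) ℝ) : ‖Mᵀ‖ = ‖M‖ := by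
  rw [← Matrix.conjTranspose_eq_transpose_of_trivial, Matrix.l2_opNorm_conjTranspose]

theorem le_iff_isSymm_dotProduct {M N : Matrix (Fin n) (Fin n) ℝ} :
    M ≤ N ↔ (N - M).IsSymm ∧ ∀ x, x ⬝ᵥ (M *ᵥ x) ≤ x ⬝ᵥ (N *ᵥ x) := by
  rw [Matrix.le_iff, Matrix.posSemidef_iff_dotProduct_mulVec, Matrix.IsHermitian, Matrix.IsSymm,
    Matrix.conjTranspose_eq_transpose_of_trivial]
  simp [Matrix.sub_mulVec]

theorem smul_one_le_iff {M : Matrix (Fin n) (Fin n) ℝ} {c : ℝ} :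
    c • 1 ≤ M ↔ M.IsSymm ∧ ∀ x, c * (x ⬝ᵥ x) ≤ x ⬝ᵥ (M *ᵥ x) := by
  rw [le_iff_isSymm_dotProduct]
  simp [Matrix.IsSymm, Matrix.smul_mulVec]

theorem le_smul_one_iff {M : Matrix (Fin n) (Fin n) ℝ} {c : ℝ} :
    M ≤ c • 1 ↔ M.IsSymm ∧ ∀ x, x ⬝ᵥ (M *ᵥ x) ≤ c * (x ⬝ᵥ x) := by
  rw [le_iff_isSymm_dotProduct]
  simp [Matrix.IsSymm, Matrix.smul_mulVec]

theorem isSymm_dotProduct_mulVec_comm {M : Matrix (Fin n) (Fin n) ℝ} (hM : M.IsSymm)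
    (x y : Fin n → ℝ) : x ⬝ᵥ (M *ᵥ y) = y ⬝ᵥ (M *ᵥ x) := by
  conv_lhs => rw [← hM.eq, ← mulVec_dotProduct_eq, dotProduct_comm]

/-- A symmetric matrix with `0 ≤ M ≤ α` satisfies `|M z| ≤ α |z|`. -/
theorem mulVec_dotProduct_self_le_of_form_le {M : Matrix (Fin n) (Fin n) ℝ}
    (hM : ∀ x y, x ⬝ᵥ (M *ᵥ y) = y ⬝ᵥ (M *ᵥ x))
    {α : ℝ} (hα : 0 < α) (h0 : ∀ x, 0 ≤ x ⬝ᵥ (M *ᵥ x)) (h1 : ∀ x, x ⬝ᵥ (M *ᵥ x) ≤ α * (x ⬝ᵥ x)) (z : Fin n → ℝ) :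
    (M *ᵥ z) ⬝ᵥ (M *ᵥ z) ≤ α ^ 2 * (z ⬝ᵥ z) := by
  -- Nonnegativity at `α z - M z`, with the upper bound at `M z`, yields `|M z|² ≤ α (z ⬝ᵥ M z)`;
  -- the upper bound at `z` finishes.
  have ha := h0 (α • z - M *ᵥ z)
  have hb := h1 (M *ᵥ z)
  have hc := h1 z
  have e1 := hM z (M *ᵥ z)
  simp only [Matrix.mulVec_sub, Matrix.mulVec_smul, sub_dotProduct, dotProduct_sub, smul_dotProduct,
    dotProduct_smul, smul_eq_mul] at ha
  rw [e1] at ha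
  have h2 : α * ((M *ᵥ z) ⬝ᵥ (M *ᵥ z)) ≤ α * (α * (z ⬝ᵥ (M *ᵥ z))) := by nlinarith
  have h3 := le_of_mul_le_mul_left h2 hα
  nlinarith

section Coercive

variable {M : Matrix (Fin n) (Fin n) ℝ} {γ : ℝ}

theorem isUnit_det_of_coercive (hγ : 0 < γ) (h : ∀ x, γ * (x ⬝ᵥ x) ≤ x ⬝ᵥ (M *ᵥ x)) :
    IsUnit M.det := by
  rw [← Matrix.isUnit_iff_isUnit_det, ← Matrix.mulVec_injective_iff_isUnit]
  refine (injective_iff_map_eq_zero M.mulVecLin).2 fun x hx => ?_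
  have := h x
  rw [Matrix.mulVecLin_apply] at hx
  rw [hx, dotProduct_zero] at this
  exact eq_zero_of_dotProduct_self_nonpos (nonpos_of_mul_nonpos_right this hγ)

/-- Coercivity at `z = M⁻¹ y` reads `γ |z|² ≤ y ⬝ᵥ z`; combined with `0 ≤ |y - γ z|²` this gives all
three bounds without symmetry. It serves both for `R` and for the Gramian. -/
theorem inv_coercive_bounds (hγ : 0 < γ) (h : ∀ x, γ * (x ⬝ᵥ x) ≤ x ⬝ᵥ (M *ᵥ x)) (y : Fin n → ℝ) :
    0 ≤ y ⬝ᵥ (M⁻¹ *ᵥ y) ∧ y ⬝ᵥ (M⁻¹ *ᵥ y) ≤ 1 / γ * (y ⬝ᵥ y) ∧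
      (M⁻¹ *ᵥ y) ⬝ᵥ (M⁻¹ *ᵥ y) ≤ (1 / γ) ^ 2 * (y ⬝ᵥ y) := by
  have hu := isUnit_det_of_coercive hγ h
  have h1 := h (M⁻¹ *ᵥ y)
  rw [Matrix.mulVec_mulVec, Matrix.mul_nonsing_inv _ hu, Matrix.one_mulVec] at h1
  have h2 := dotProduct_self_nonneg' (y - γ • (M⁻¹ *ᵥ y))
  have h3 := dotProduct_self_nonneg' (M⁻¹ *ᵥ y)
  simp only [sub_dotProduct, dotProduct_sub, smul_dotProduct, dotProduct_smul, smul_eq_mul] at h2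
  rw [dotProduct_comm (M⁻¹ *ᵥ y) y] at h1 h2
  have h4 : 0 ≤ y ⬝ᵥ (M⁻¹ *ᵥ y) := (mul_nonneg hγ.le h3).trans h1
  have h5 : γ * (y ⬝ᵥ (M⁻¹ *ᵥ y)) ≤ y ⬝ᵥ y := by nlinarith
  refine ⟨h4, ?_, ?_⟩
  · rw [one_div, inv_mul_eq_div, le_div_iff₀ hγ]
    linarith
  · rw [one_div, inv_pow, inv_mul_eq_div, le_div_iff₀ (by positivity)]
    nlinarith

end Coercive

end DotProduct

/-! ### Entrywise calculus for matrix functions, and monotonicity -/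

section Calculus

variable {l m n : ℕ} {s : Set ℝ} {t : ℝ}

/-- The norm on matrices is the operator norm, not a product norm; in finite dimension the linear
identification with families of entries is still a homeomorphism, so derivatives can be taken
entrywise. This gives product rules for rectangular matrices. -/
theorem hasDerivWithinAt_matrix_iff {M : ℝ → Matrix (Fin m) (Fin n) ℝ} {M' : Matrix (Fin m) (Fin n) ℝ} :
    HasDerivWithinAt M M' s t ↔ ∀ i j, HasDerivWithinAt (fun τ => M τ i j) (M' i j) s t := by
  let e : Matrix (Fin m) (Fin n) ℝ ≃L[ℝ] (Fin m → Fin n → ℝ) :=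
    LinearEquiv.toContinuousLinearEquiv (Matrix.ofLinearEquiv ℝ).symm
  have : HasDerivWithinAt M M' s t ↔ HasDerivWithinAt (fun τ => e (M τ)) (e M') s t := by
    refine ⟨fun h => e.hasFDerivAt.comp_hasDerivWithinAt t h, fun h => ?_⟩
    simpa using! e.symm.hasFDerivAt.comp_hasDerivWithinAt t h
  rw [this]
  simp only [hasDerivWithinAt_pi]
  rfl

theorem continuousOn_matrix_iff {M : ℝ → Matrix (Fin m) (Fin n) ℝ} :
    ContinuousOn M s ↔ ∀ i j, ContinuousOn (fun τ => M τ i j) s := by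
  let e : Matrix (Fin m) (Fin n) ℝ ≃L[ℝ] (Fin m → Fin n → ℝ) :=
    LinearEquiv.toContinuousLinearEquiv (Matrix.ofLinearEquiv ℝ).symm
  have : ContinuousOn M s ↔ ContinuousOn (fun τ => e (M τ)) s := by
    refine ⟨fun h => e.continuous.comp_continuousOn h, fun h => ?_⟩
    simpa using! e.symm.continuous.comp_continuousOn h
  rw [this]
  simp only [continuousOn_pi]
  rfl

theorem _root_.HasDerivWithinAt.matrix_mul' {M : ℝ → Matrix (Fin l) (Fin m) ℝ}
    {N : ℝ → Matrix (Fin m) (Fin n) ℝ} {M' N'} (hM : HasDerivWithinAt M M' s t)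
    (hN : HasDerivWithinAt N N' s t) :
    HasDerivWithinAt (fun τ => M τ * N τ) (M' * N t + M t * N') s t := by
  rw [hasDerivWithinAt_matrix_iff] at *
  intro i j
  simp only [Matrix.mul_apply, Matrix.add_apply, ← Finset.sum_add_distrib]
  exact HasDerivWithinAt.fun_sum fun k _ => (hM i k).mul (hN k j)

theorem _root_.HasDerivWithinAt.mulVec' {M : ℝ → Matrix (Fin m) (Fin n) ℝ}
    {x : ℝ → Fin n → ℝ} {M' x'} (hM : HasDerivWithinAt M M' s t)
    (hx : HasDerivWithinAt x x' s t) :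
    HasDerivWithinAt (fun τ => M τ *ᵥ x τ) (M' *ᵥ x t + M t *ᵥ x') s t := by
  rw [hasDerivWithinAt_matrix_iff] at hM
  rw [hasDerivWithinAt_pi] at *
  intro i
  simp only [Matrix.mulVec, dotProduct, Pi.add_apply, ← Finset.sum_add_distrib]
  exact HasDerivWithinAt.fun_sum fun k _ => (hM i k).mul (hx k)

theorem _root_.HasDerivWithinAt.mulVec_const' {M : ℝ → Matrix (Fin m) (Fin n) ℝ}
    {M'} (hM : HasDerivWithinAt M M' s t) (x : Fin n → ℝ) :
    HasDerivWithinAt (fun τ => M τ *ᵥ x) (M' *ᵥ x) s t := by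
  simpa using hM.mulVec' (hasDerivWithinAt_const t s x)

theorem _root_.HasDerivWithinAt.dotProduct' {x y : ℝ → Fin n → ℝ} {x' y'}
    (hx : HasDerivWithinAt x x' s t) (hy : HasDerivWithinAt y y' s t) :
    HasDerivWithinAt (fun τ => x τ ⬝ᵥ y τ) (x' ⬝ᵥ y t + x t ⬝ᵥ y') s t := by
  rw [hasDerivWithinAt_pi] at *
  simp only [dotProduct, ← Finset.sum_add_distrib]
  exact HasDerivWithinAt.fun_sum fun k _ => (hx k).mul (hy k)

theorem _root_.HasDerivWithinAt.matrix_transpose' {M : ℝ → Matrix (Fin m) (Fin n) ℝ}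
    {M'} (hM : HasDerivWithinAt M M' s t) :
    HasDerivWithinAt (fun τ => (M τ)ᵀ) M'ᵀ s t := by
  rw [hasDerivWithinAt_matrix_iff] at *
  exact fun i j => hM j i

theorem _root_.HasDerivWithinAt.matrix_inv' {M : ℝ → Matrix (Fin n) (Fin n) ℝ}
    {M'} (hM : HasDerivWithinAt M M' s t) (hu : IsUnit (M t)) :
    HasDerivWithinAt (fun τ => (M τ)⁻¹) (-((M t)⁻¹ * M' * (M t)⁻¹)) s t := by
  obtain ⟨u, hu⟩ := hu
  have h := hasFDerivAt_ringInverse (𝕜 := ℝ) u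
  rw [hu] at h
  have := h.comp_hasDerivWithinAt t hM
  simp only [Matrix.nonsing_inv_eq_ringInverse]
  refine this.congr_deriv ?_
  rw [← hu, Ring.inverse_unit]
  simp

theorem _root_.ContinuousOn.matrix_mul' {M : ℝ → Matrix (Fin l) (Fin m) ℝ}
    {N : ℝ → Matrix (Fin m) (Fin n) ℝ} (hM : ContinuousOn M s) (hN : ContinuousOn N s) :
    ContinuousOn (fun τ => M τ * N τ) s := by
  rw [continuousOn_matrix_iff] at *
  intro i j
  simp only [Matrix.mul_apply]
  exact continuousOn_finsetSum _ fun k _ => (hM i k).mul (hN k j)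

theorem _root_.ContinuousOn.matrix_transpose' {M : ℝ → Matrix (Fin m) (Fin n) ℝ}
    (hM : ContinuousOn M s) : ContinuousOn (fun τ => (M τ)ᵀ) s := by
  rw [continuousOn_matrix_iff] at *
  exact fun i j => hM j i

theorem _root_.ContinuousOn.matrix_inv' {M : ℝ → Matrix (Fin n) (Fin n) ℝ}
    (hM : ContinuousOn M s) (hu : ∀ t ∈ s, IsUnit (M t)) : ContinuousOn (fun τ => (M τ)⁻¹) s := by
  intro t ht
  obtain ⟨u, hu⟩ := hu t ht
  have h := NormedRing.inverse_continuousAt u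
  rw [hu] at h
  simp only [Matrix.nonsing_inv_eq_ringInverse]
  exact ContinuousAt.comp_continuousWithinAt (f := M) h (hM t ht)

/-- Integral estimates below are phrased as monotonicity of a function plus an explicit
antiderivative of its bound. Derivatives are taken within the larger interval `[a, b]`, the form in
which the differential equations are given. -/
theorem le_of_hasDerivWithinAt_nonneg {a b : ℝ} {f f' : ℝ → ℝ} {x y : ℝ} (hx : a ≤ x) (hxy : x ≤ y)
    (hy : y ≤ b) (hf : ∀ t ∈ Set.Icc x y, HasDerivWithinAt f (f' t) (Set.Icc a b) t)
    (h0 : ∀ t ∈ Set.Icc x y, 0 ≤ f' t) : f x ≤ f y := by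
  have hf' : ∀ t ∈ Set.Icc x y, HasDerivWithinAt f (f' t) (Set.Icc x y) t := fun t ht =>
    (hf t ht).mono (Set.Icc_subset_Icc hx hy)
  exact monotoneOn_of_hasDerivWithinAt_nonneg (convex_Icc x y)
    (fun t ht => (hf' t ht).continuousWithinAt)
    (fun t ht => (hf' t (interior_subset ht)).mono interior_subset)
    (fun t ht => h0 t (interior_subset ht)) ⟨le_rfl, hxy⟩ ⟨hxy, le_rfl⟩ hxy

theorem hasDerivWithinAt_exp_mul_sub (c t₀ : ℝ) :
    HasDerivWithinAt (fun τ => Real.exp (c * (τ - t₀))) (c * Real.exp (c * (t - t₀))) s t := by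
  have h : HasDerivAt (fun τ => c * (τ - t₀)) c t := by
    simpa using ((hasDerivAt_id t).sub_const t₀).const_mul c
  exact (h.exp.congr_deriv (by ring)).hasDerivWithinAt

end Calculus

/-! ### Gronwall estimates by integrating factors -/

section Growth

variable {n : ℕ} {a b : ℝ}

/-- Upper growth bound for solutions of linear systems. -/
theorem dotProduct_self_le_exp {x x' : ℝ → Fin n → ℝ} {c s t : ℝ}
    (hs : a ≤ s) (hst : s ≤ t) (ht : t ≤ b)
    (hx : ∀ τ ∈ Set.Icc s t, HasDerivWithinAt x (x' τ) (Set.Icc a b) τ)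
    (hc : ∀ τ ∈ Set.Icc s t, x τ ⬝ᵥ x' τ ≤ c * (x τ ⬝ᵥ x τ)) :
    x t ⬝ᵥ x t ≤ Real.exp (2 * c * (t - s)) * (x s ⬝ᵥ x s) := by
  have key := le_of_hasDerivWithinAt_nonneg hs hst ht
    (f := fun τ => - (Real.exp (-(2 * c) * (τ - s)) * (x τ ⬝ᵥ x τ)))
    (fun τ hτ => ((hasDerivWithinAt_exp_mul_sub (-(2 * c)) s).mul
      ((hx τ hτ).dotProduct' (hx τ hτ))).neg) (fun τ hτ => by
        have h1 := hc τ hτ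
        have h2 := Real.exp_pos (-(2 * c) * (τ - s))
        rw [dotProduct_comm (x' τ)]
        nlinarith)
  simp only [sub_self, mul_zero, Real.exp_zero, one_mul, neg_le_neg_iff] at key
  calc x t ⬝ᵥ x t = Real.exp (2 * c * (t - s)) * (Real.exp (-(2 * c) * (t - s)) * (x t ⬝ᵥ x t)) := by
        rw [← mul_assoc, ← Real.exp_add]; simp
    _ ≤ _ := mul_le_mul_of_nonneg_left key (Real.exp_pos _).le

/-- Lower growth bound for solutions of linear systems. -/
theorem exp_dotProduct_self_le {x x' : ℝ → Fin n → ℝ} {c s t : ℝ}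
    (hs : a ≤ s) (hst : s ≤ t) (ht : t ≤ b)
    (hx : ∀ τ ∈ Set.Icc s t, HasDerivWithinAt x (x' τ) (Set.Icc a b) τ)
    (hc : ∀ τ ∈ Set.Icc s t, -(c * (x τ ⬝ᵥ x τ)) ≤ x τ ⬝ᵥ x' τ) :
    x s ⬝ᵥ x s ≤ Real.exp (2 * c * (t - s)) * (x t ⬝ᵥ x t) := by
  have key := le_of_hasDerivWithinAt_nonneg hs hst ht
    (f := fun τ => Real.exp (2 * c * (τ - s)) * (x τ ⬝ᵥ x τ))
    (fun τ hτ => (hasDerivWithinAt_exp_mul_sub (2 * c) s).mul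
      ((hx τ hτ).dotProduct' (hx τ hτ))) (fun τ hτ => by
        have h1 := hc τ hτ
        have h2 := Real.exp_pos (2 * c * (τ - s))
        rw [dotProduct_comm (x' τ)]
        nlinarith)
  simpa using key

end Growth

/-! ### Cocycle property and growth of the evolution operator -/

section EvolutionCocycle

variable {n : ℕ} {a b : ℝ} {A : ℝ → Matrix (Fin n) (Fin n) ℝ}

theorem evolutionOperator_mulVec_hasDerivWithinAt (hA : ContinuousOn A (Set.Icc a b)) {s t : ℝ}
    (hs : s ∈ Set.Icc a b) (ht : t ∈ Set.Icc a b) (v : Fin n → ℝ) :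
    HasDerivWithinAt (fun t => evolutionOperator A t s *ᵥ v)
      (A t *ᵥ (evolutionOperator A t s *ᵥ v)) (Set.Icc a b) t := by
  rw [Matrix.mulVec_mulVec]
  exact (evolutionOperator_hasDerivWithinAt hA hs ht).mulVec_const' v

theorem exists_linear_solution (hA : ContinuousOn A (Set.Icc a b)) {s : ℝ}
    (hs : s ∈ Set.Icc a b) (v : Fin n → ℝ) :
    ∃ x : ℝ → Fin n → ℝ,
      (∀ t ∈ Set.Icc a b, HasDerivWithinAt x (A t *ᵥ x t) (Set.Icc a b) t) ∧ x s = v :=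
  ⟨fun t => evolutionOperator A t s *ᵥ v,
    fun _ ht => evolutionOperator_mulVec_hasDerivWithinAt hA hs ht v,
    by simp [evolutionOperator_self]⟩

/-- Uniqueness for the linear equation, applied to `t ↦ Φ(t, r) v`. -/
theorem evolutionOperator_mul (hA : ContinuousOn A (Set.Icc a b)) {r s t : ℝ}
    (hr : r ∈ Set.Icc a b) (hs : s ∈ Set.Icc a b) (ht : t ∈ Set.Icc a b) :
    evolutionOperator A t s * evolutionOperator A s r = evolutionOperator A t r := by
  refine Matrix.mulVec_injective (funext fun v => ?_)
  rw [← Matrix.mulVec_mulVec]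
  exact (eq_evolutionOperator_mulVec hA
    (fun τ hτ => evolutionOperator_mulVec_hasDerivWithinAt hA hr hτ v) hs ht).symm

theorem evolutionOperator_mul_swap (hA : ContinuousOn A (Set.Icc a b)) {s t : ℝ}
    (hs : s ∈ Set.Icc a b) (ht : t ∈ Set.Icc a b) :
    evolutionOperator A t s * evolutionOperator A s t = 1 := by
  rw [evolutionOperator_mul hA ht hs ht, evolutionOperator_self]

theorem evolutionOperator_continuousOn (hA : ContinuousOn A (Set.Icc a b)) {s : ℝ}
    (hs : s ∈ Set.Icc a b) : ContinuousOn (fun t => evolutionOperator A t s) (Set.Icc a b) :=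
  fun _ ht => (evolutionOperator_hasDerivWithinAt hA hs ht).continuousWithinAt

/-- Regularity in the second argument comes from `Φ(s, t) = Φ(t, s)⁻¹` and continuity of inversion;
the Gramian integrand requires it. -/
theorem evolutionOperator_continuousOn_right (hA : ContinuousOn A (Set.Icc a b)) {s : ℝ}
    (hs : s ∈ Set.Icc a b) : ContinuousOn (fun t => evolutionOperator A s t) (Set.Icc a b) := by
  have hu : ∀ t ∈ Set.Icc a b, IsUnit (evolutionOperator A t s) := fun t ht =>
    ((Matrix.isUnit_iff_isUnit_det _).2 (Matrix.isUnit_det_of_right_inverse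
      (evolutionOperator_mul_swap hA hs ht)))
  refine ((evolutionOperator_continuousOn hA hs).matrix_inv' hu).congr fun t ht => ?_
  exact (Matrix.inv_eq_left_inv (evolutionOperator_mul_swap hA ht hs)).symm

theorem evolutionOperator_forward_le (hA : ContinuousOn A (Set.Icc a b)) {c : ℝ}
    (hc : ∀ t ∈ Set.Icc a b, ‖A t‖ ≤ c) {s t : ℝ} (hs : a ≤ s) (hst : s ≤ t) (ht : t ≤ b)
    (v : Fin n → ℝ) :
    (evolutionOperator A t s *ᵥ v) ⬝ᵥ (evolutionOperator A t s *ᵥ v) ≤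
      Real.exp (2 * c * (t - s)) * (v ⬝ᵥ v) := by
  have hI : ∀ τ ∈ Set.Icc s t, τ ∈ Set.Icc a b := fun τ hτ => ⟨hs.trans hτ.1, hτ.2.trans ht⟩
  simpa [evolutionOperator_self] using dotProduct_self_le_exp hs hst ht
    (fun τ hτ => evolutionOperator_mulVec_hasDerivWithinAt hA (hI s ⟨le_rfl, hst⟩) (hI τ hτ) v)
    (fun τ hτ => (abs_le.1 (abs_dotProduct_mulVec_le (hc τ (hI τ hτ)) _)).2)

theorem evolutionOperator_backward_le (hA : ContinuousOn A (Set.Icc a b)) {c : ℝ}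
    (hc : ∀ t ∈ Set.Icc a b, ‖A t‖ ≤ c) {s t : ℝ} (hs : a ≤ s) (hst : s ≤ t) (ht : t ≤ b)
    (v : Fin n → ℝ) :
    (evolutionOperator A s t *ᵥ v) ⬝ᵥ (evolutionOperator A s t *ᵥ v) ≤
      Real.exp (2 * c * (t - s)) * (v ⬝ᵥ v) := by
  have hI : ∀ τ ∈ Set.Icc s t, τ ∈ Set.Icc a b := fun τ hτ => ⟨hs.trans hτ.1, hτ.2.trans ht⟩
  simpa [evolutionOperator_self] using exp_dotProduct_self_le hs hst ht
    (fun τ hτ => evolutionOperator_mulVec_hasDerivWithinAt hA (hI t ⟨hst, le_rfl⟩) (hI τ hτ) v)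
    (fun τ hτ => (abs_le.1 (abs_dotProduct_mulVec_le (hc τ (hI τ hτ)) _)).1)

theorem evolutionOperator_transpose_norm_le (hA : ContinuousOn A (Set.Icc a b)) {c : ℝ}
    (hc : ∀ t ∈ Set.Icc a b, ‖A t‖ ≤ c) {s t : ℝ} (hs : a ≤ s) (hst : s ≤ t) (ht : t ≤ b) :
    ‖(evolutionOperator A s t)ᵀ‖ ≤ Real.exp (c * (t - s)) := by
  rw [norm_transpose_eq]
  refine norm_le_of_mulVec_dotProduct_self_le (Real.exp_pos _).le fun v => ?_
  rw [← Real.exp_nat_mul]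
  refine (evolutionOperator_backward_le hA hc hs hst ht v).trans_eq ?_
  push_cast
  ring_nf

end EvolutionCocycle

/-! ### The Gramian as a differentiable function of its end point -/

section Gramian

variable {nx nu : ℕ} {a b : ℝ} {A : ℝ → Matrix (Fin nx) (Fin nx) ℝ}
  {B : ℝ → Matrix (Fin nx) (Fin nu) ℝ}

/-- Everything later uses the Gramian only through this derivative and its vanishing at `t = s`. -/
theorem gramian_hasDerivWithinAt (hA : ContinuousOn A (Set.Icc a b))
    (hB : ContinuousOn B (Set.Icc a b)) {s t : ℝ}
    (hs : s ∈ Set.Icc a b) (ht : t ∈ Set.Icc a b) :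
    HasDerivWithinAt (fun t => gramian A B s t)
      (evolutionOperator A s t * B t * (B t)ᵀ * (evolutionOperator A s t)ᵀ) (Set.Icc a b) t := by
  have hc : ContinuousOn
      (fun t => evolutionOperator A s t * B t * (B t)ᵀ * (evolutionOperator A s t)ᵀ)
      (Set.Icc a b) :=
    (((evolutionOperator_continuousOn_right hA hs).matrix_mul' hB).matrix_mul'
      hB.matrix_transpose').matrix_mul' (evolutionOperator_continuousOn_right hA hs).matrix_transpose'
  have : Fact (t ∈ Set.Icc a b) := ⟨ht⟩
  exact intervalIntegral.integral_hasDerivWithinAt_right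
    ((hc.mono (Set.uIcc_subset_Icc hs ht)).intervalIntegrable)
    (hc.stronglyMeasurableAtFilter_nhdsWithin measurableSet_Icc t) (hc t ht)

theorem gramian_self (A : ℝ → Matrix (Fin nx) (Fin nx) ℝ) (B : ℝ → Matrix (Fin nx) (Fin nu) ℝ)
    (t : ℝ) : gramian A B t t = 0 := intervalIntegral.integral_same

end Gramian

/-- `S` solves the Riccati equation `Ṡ = S G S - S F - Fᵀ S - Q` on `[a, b]`. -/
def SolvesRiccati {n : ℕ} (F G Q S : ℝ → Matrix (Fin n) (Fin n) ℝ) (a b : ℝ) : Prop :=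
  ∀ t ∈ Set.Icc a b, HasDerivWithinAt S
    (S t * G t * S t - S t * F t - (F t)ᵀ * S t - Q t) (Set.Icc a b) t

/-! ### Riccati equations: uniqueness, existence, comparison and decay -/

section Riccati

variable {n : ℕ} {F G Q S : ℝ → Matrix (Fin n) (Fin n) ℝ} {a b : ℝ}

theorem SolvesRiccati.continuousOn (hS : SolvesRiccati F G Q S a b) :
    ContinuousOn S (Set.Icc a b) := fun t ht => (hS t ht).continuousWithinAt

/-- The difference `D = S - S'` satisfies `Ḋ = (S' G - Fᵀ) D - D (F - G S)`. Multiplying on the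
right by the evolution operator of `F - G S` absorbs the last term and leaves a linear equation with
zero terminal value. -/
theorem SolvesRiccati.eqOn {S' : ℝ → Matrix (Fin n) (Fin n) ℝ}
    (hF : ContinuousOn F (Set.Icc a b)) (hG : ContinuousOn G (Set.Icc a b))
    (hS : SolvesRiccati F G Q S a b) (hS' : SolvesRiccati F G Q S' a b) (hb : S b = S' b) :
    Set.EqOn S S' (Set.Icc a b) := by
  intro t ht
  have hbI : b ∈ Set.Icc a b := ⟨ht.1.trans ht.2, le_rfl⟩
  have hK : ContinuousOn (fun τ => F τ - G τ * S τ) (Set.Icc a b) :=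
    hF.sub (hG.matrix_mul' hS.continuousOn)
  have hL : ContinuousOn (fun τ => S' τ * G τ - (F τ)ᵀ) (Set.Icc a b) :=
    (hS'.continuousOn.matrix_mul' hG).sub hF.matrix_transpose'
  set Φ := fun τ => evolutionOperator (fun τ => F τ - G τ * S τ) τ b with hΦ
  have hzero : (S t - S' t) * Φ t = 0 := by
    refine Matrix.mulVec_injective (funext fun v => ?_)
    have := eq_evolutionOperator_mulVec (x := fun τ => ((S τ - S' τ) * Φ τ) *ᵥ v) hL
      (fun τ hτ => ?_) hbI ht
    · simpa [hb] using this
    · have h := (((hS τ hτ).sub (hS' τ hτ)).matrix_mul'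
        (evolutionOperator_hasDerivWithinAt hK hbI hτ)).mulVec_const' v
      refine h.congr_deriv ?_
      rw [Matrix.mulVec_mulVec]
      simp only [hΦ, Pi.sub_apply]
      generalize evolutionOperator _ τ b = U
      congr 1
      noncomm_ring
  have := congrArg (· * evolutionOperator (fun τ => F τ - G τ * S τ) b t) hzero
  simpa [hΦ, Matrix.mul_assoc, evolutionOperator_mul_swap hK hbI ht, sub_eq_zero] using this

/-- `Sᵀ` solves the same terminal value problem, so uniqueness applies. -/
theorem SolvesRiccati.isSymm (hF : ContinuousOn F (Set.Icc a b))
    (hG : ContinuousOn G (Set.Icc a b)) (hGs : ∀ t ∈ Set.Icc a b, (G t).IsSymm)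
    (hQs : ∀ t ∈ Set.Icc a b, (Q t).IsSymm) (hS : SolvesRiccati F G Q S a b)
    (hb : (S b).IsSymm) {t : ℝ} (ht : t ∈ Set.Icc a b) : (S t).IsSymm := by
  refine SolvesRiccati.eqOn hF hG (S := fun τ => (S τ)ᵀ) (fun τ hτ => ?_) hS hb ht
  refine (hS τ hτ).matrix_transpose'.congr_deriv ?_
  simp only [Matrix.transpose_sub, Matrix.transpose_mul, Matrix.transpose_transpose,
    (hGs τ hτ).eq, (hQs τ hτ).eq]
  noncomm_ring

/-- The coefficient matrix of the Hamiltonian system `ẋ = F x - G y`, `ẏ = -Q x - Fᵀ y`. -/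
noncomputable def hamiltonian (F G Q : ℝ → Matrix (Fin n) (Fin n) ℝ) (t : ℝ) :
    Matrix (Fin (n + n)) (Fin (n + n)) ℝ :=
  (Matrix.fromBlocks (F t) (-G t) (-Q t) (-(F t)ᵀ)).submatrix finSumFinEquiv.symm
    finSumFinEquiv.symm

theorem hamiltonian_continuousOn (hF : ContinuousOn F (Set.Icc a b))
    (hG : ContinuousOn G (Set.Icc a b)) (hQ : ContinuousOn Q (Set.Icc a b)) :
    ContinuousOn (hamiltonian F G Q) (Set.Icc a b) := by
  rw [continuousOn_matrix_iff] at *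
  intro i j
  simp only [hamiltonian, Matrix.submatrix_apply]
  rcases finSumFinEquiv.symm i with i | i <;> rcases finSumFinEquiv.symm j with j | j
  · exact hF i j
  · exact (hG i j).neg
  · exact (hQ i j).neg
  · exact (hF j i).neg

/-- The system is linear, so its evolution operator applied to the stacked terminal block `(I, K)`
exists on all of `[a, b]`; `X` and `Y` are the two row blocks. -/
theorem exists_hamiltonian_solution (hab : a ≤ b) (hF : ContinuousOn F (Set.Icc a b))
    (hG : ContinuousOn G (Set.Icc a b)) (hQ : ContinuousOn Q (Set.Icc a b))
    (K : Matrix (Fin n) (Fin n) ℝ) :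
    ∃ X Y : ℝ → Matrix (Fin n) (Fin n) ℝ, X b = 1 ∧ Y b = K ∧
      (∀ t ∈ Set.Icc a b, HasDerivWithinAt X (F t * X t - G t * Y t) (Set.Icc a b) t) ∧
      ∀ t ∈ Set.Icc a b, HasDerivWithinAt Y (-(Q t * X t) - (F t)ᵀ * Y t) (Set.Icc a b) t := by
  set J : Matrix (Fin (n + n)) (Fin n) ℝ :=
    (Matrix.fromRows 1 K).submatrix finSumFinEquiv.symm id with hJ
  set Ψ : ℝ → Matrix (Fin (n + n)) (Fin n) ℝ :=
    fun t => evolutionOperator (hamiltonian F G Q) t b * J with hΨ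
  have hd : ∀ t ∈ Set.Icc a b, HasDerivWithinAt Ψ (hamiltonian F G Q t * Ψ t) (Set.Icc a b) t := by
    intro t ht
    have := (evolutionOperator_hasDerivWithinAt (hamiltonian_continuousOn hF hG hQ) ⟨hab, le_rfl⟩
      ht).matrix_mul' (hasDerivWithinAt_const t (Set.Icc a b)
        J)
    refine this.congr_deriv ?_
    simp only [hΨ, Matrix.mul_zero, add_zero, Matrix.mul_assoc]
  refine ⟨fun t => (Ψ t).submatrix (Fin.castAdd n) id, fun t => (Ψ t).submatrix (Fin.natAdd n) id,
    ?_, ?_, fun t ht => ?_, fun t ht => ?_⟩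
  · ext i j
    simp only [hΨ, evolutionOperator_self, Matrix.submatrix_apply, Matrix.one_mul]
    simp [hJ, -Fin.natAdd_eq_addNat]
  · ext i j
    simp only [hΨ, evolutionOperator_self, Matrix.submatrix_apply, Matrix.one_mul]
    simp [hJ, -Fin.natAdd_eq_addNat]
  all_goals
    have h := hasDerivWithinAt_matrix_iff.1 (hd t ht)
    refine hasDerivWithinAt_matrix_iff.2 fun i j => ?_
  · refine (h (Fin.castAdd n i) j).congr_deriv ?_
    simp [Matrix.mul_apply, Fin.sum_univ_add, hamiltonian, sub_eq_add_neg, -Fin.natAdd_eq_addNat]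
  · refine (h (Fin.natAdd n i) j).congr_deriv ?_
    simp [Matrix.mul_apply, Fin.sum_univ_add, hamiltonian, sub_eq_add_neg, -Fin.natAdd_eq_addNat]

/-- `S = Y X⁻¹` works once `X` is invertible. If `X(t) ξ = 0`, the pairing `Xξ ⬝ᵥ Yξ` vanishes at
`t` and is nonincreasing, because its derivative is `-(Xξ ⬝ᵥ Q Xξ) - (Yξ ⬝ᵥ G Yξ)`. At `b` it equals
`ξ ⬝ᵥ K ξ`, so coercivity of `K` forces `ξ = 0`. -/
theorem exists_solvesRiccati (hab : a ≤ b) (hF : ContinuousOn F (Set.Icc a b))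
    (hG : ContinuousOn G (Set.Icc a b)) (hQ : ContinuousOn Q (Set.Icc a b))
    (hG0 : ∀ t ∈ Set.Icc a b, ∀ x, 0 ≤ x ⬝ᵥ (G t *ᵥ x))
    (hQ0 : ∀ t ∈ Set.Icc a b, ∀ x, 0 ≤ x ⬝ᵥ (Q t *ᵥ x))
    {K : Matrix (Fin n) (Fin n) ℝ} {γ : ℝ} (hγ : 0 < γ)
    (hK : ∀ x, γ * (x ⬝ᵥ x) ≤ x ⬝ᵥ (K *ᵥ x)) :
    ∃ S, SolvesRiccati F G Q S a b ∧ S b = K := by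
  obtain ⟨X, Y, hXb, hYb, hX, hY⟩ := exists_hamiltonian_solution hab hF hG hQ K
  have hu : ∀ t ∈ Set.Icc a b, IsUnit (X t) := by
    intro t ht
    rw [← Matrix.mulVec_injective_iff_isUnit]
    refine (injective_iff_map_eq_zero (X t).mulVecLin).2 fun ξ hξ => ?_
    rw [Matrix.mulVecLin_apply] at hξ
    have key := le_of_hasDerivWithinAt_nonneg ht.1 ht.2 le_rfl
      (f := fun τ => -((X τ *ᵥ ξ) ⬝ᵥ (Y τ *ᵥ ξ)))
      (f' := fun τ => (X τ *ᵥ ξ) ⬝ᵥ (Q τ *ᵥ (X τ *ᵥ ξ)) + (Y τ *ᵥ ξ) ⬝ᵥ (G τ *ᵥ (Y τ *ᵥ ξ)))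
      (fun τ hτ => by
        have hτ' : τ ∈ Set.Icc a b := ⟨ht.1.trans hτ.1, hτ.2⟩
        refine (((hX τ hτ').mulVec_const' ξ).dotProduct'
          ((hY τ hτ').mulVec_const' ξ)).neg.congr_deriv ?_
        simp only [Matrix.sub_mulVec, Matrix.neg_mulVec, ← Matrix.mulVec_mulVec, sub_dotProduct,
          dotProduct_sub, dotProduct_neg, mulVec_dotProduct_eq (F τ)]
        rw [dotProduct_comm (G τ *ᵥ _)]
        ring)
      (fun τ hτ => add_nonneg (hQ0 τ ⟨ht.1.trans hτ.1, hτ.2⟩ _) (hG0 τ ⟨ht.1.trans hτ.1, hτ.2⟩ _))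
    simp only [hξ, zero_dotProduct, neg_zero, hXb, hYb, Matrix.one_mulVec] at key
    exact eq_zero_of_dotProduct_self_nonpos
      (nonpos_of_mul_nonpos_right ((hK ξ).trans (by linarith)) hγ)
  refine ⟨fun t => Y t * (X t)⁻¹, fun t ht => ?_, by simp [hXb, hYb]⟩
  refine ((hY t ht).matrix_mul' ((hX t ht).matrix_inv' (hu t ht))).congr_deriv ?_
  have h1 : X t * (X t)⁻¹ = 1 :=
    Matrix.mul_nonsing_inv _ ((Matrix.isUnit_iff_isUnit_det _).1 (hu t ht))
  beta_reduce
  generalize (X t)⁻¹ = V at h1 ⊢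
  calc _ = -(Q t * (X t * V)) - (F t)ᵀ * (Y t * V) - Y t * V * F t * (X t * V)
        + Y t * V * G t * (Y t * V) := by noncomm_ring
    _ = _ := by rw [h1]; noncomm_ring

/-- Along `ẋ = x'`, the derivative of `xᵀ S x` for a symmetric solution of the Riccati equation. -/
theorem SolvesRiccati.hasDerivWithinAt_form (hS : SolvesRiccati F G Q S a b) {t : ℝ}
    (ht : t ∈ Set.Icc a b) (hSs : (S t).IsSymm) {x : ℝ → Fin n → ℝ} {x' : Fin n → ℝ}
    (hx : HasDerivWithinAt x x' (Set.Icc a b) t) :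
    HasDerivWithinAt (fun τ => x τ ⬝ᵥ (S τ *ᵥ x τ))
      ((S t *ᵥ x t) ⬝ᵥ (G t *ᵥ (S t *ᵥ x t)) - x t ⬝ᵥ (Q t *ᵥ x t)
        + 2 * ((S t *ᵥ x t) ⬝ᵥ (x' - F t *ᵥ x t))) (Set.Icc a b) t := by
  refine (hx.dotProduct' ((hS t ht).mulVec' hx)).congr_deriv ?_
  have h1 : ∀ y, x t ⬝ᵥ (S t *ᵥ y) = (S t *ᵥ x t) ⬝ᵥ y := fun y => by
    rw [mulVec_dotProduct_eq, hSs.eq]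
  simp only [Matrix.sub_mulVec, ← Matrix.mulVec_mulVec, dotProduct_add,
    dotProduct_sub, ← mulVec_dotProduct_eq (F t), h1]
  rw [dotProduct_comm (F t *ᵥ _), dotProduct_comm x']
  ring

/-- Comparison with the constant subsolution `c I`: the condition `2 ω c + β c² ≤ γ` makes the form
of `S - c I` nonincreasing along a suitable linear flow, and it is nonnegative at `b`. -/
theorem SolvesRiccati.le_form (hF : ContinuousOn F (Set.Icc a b)) (hG : ContinuousOn G (Set.Icc a b))
    (hGs : ∀ t ∈ Set.Icc a b, (G t).IsSymm)
    (hS : SolvesRiccati F G Q S a b) (hSs : ∀ t ∈ Set.Icc a b, (S t).IsSymm)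
    {ω β γ c : ℝ} (hc : 0 ≤ c) (hω : ∀ t ∈ Set.Icc a b, ∀ x, -(ω * (x ⬝ᵥ x)) ≤ x ⬝ᵥ (F t *ᵥ x))
    (hβ : ∀ t ∈ Set.Icc a b, ∀ x, x ⬝ᵥ (G t *ᵥ x) ≤ β * (x ⬝ᵥ x))
    (hγ : ∀ t ∈ Set.Icc a b, ∀ x, γ * (x ⬝ᵥ x) ≤ x ⬝ᵥ (Q t *ᵥ x))
    (hcγ : 2 * ω * c + β * c ^ 2 ≤ γ) (hb : ∀ x, c * (x ⬝ᵥ x) ≤ x ⬝ᵥ (S b *ᵥ x))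
    {t : ℝ} (ht : t ∈ Set.Icc a b) (v : Fin n → ℝ) : c * (v ⬝ᵥ v) ≤ v ⬝ᵥ (S t *ᵥ v) := by
  -- With `N = F - G (S + c I) / 2` the terms quadratic in `S` cancel: the derivative of `xᵀ (S - c
  -- I) x` along `ẋ = N x` is `-xᵀ Q x - 2 c xᵀ F x + c² xᵀ G x`.
  obtain ⟨N, hN⟩ : ∃ N : ℝ → Matrix (Fin n) (Fin n) ℝ, ∀ τ, N τ = F τ - (1 / 2 : ℝ) • (G τ * S τ) -
    (c / 2) • G τ := ⟨_, fun _ => rfl⟩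
  have hNc : ContinuousOn N (Set.Icc a b) :=
    ((hF.sub ((hG.matrix_mul' hS.continuousOn).const_smul (1 / 2 : ℝ))).sub
      (hG.const_smul (c / 2))).congr fun τ _ => hN τ
  obtain ⟨x, hx, hxt⟩ := exists_linear_solution hNc ht v
  have key := le_of_hasDerivWithinAt_nonneg ht.1 ht.2 le_rfl
    (f := fun τ => c * (x τ ⬝ᵥ x τ) - x τ ⬝ᵥ (S τ *ᵥ x τ))
    (f' := fun τ => c * ((N τ *ᵥ x τ) ⬝ᵥ x τ + x τ ⬝ᵥ (N τ *ᵥ x τ)) -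
      ((S τ *ᵥ x τ) ⬝ᵥ (G τ *ᵥ (S τ *ᵥ x τ)) - x τ ⬝ᵥ (Q τ *ᵥ x τ)
        + 2 * ((S τ *ᵥ x τ) ⬝ᵥ (N τ *ᵥ x τ - F τ *ᵥ x τ))))
    (fun τ hτ => by
      have hτ' : τ ∈ Set.Icc a b := ⟨ht.1.trans hτ.1, hτ.2⟩
      exact (((hx τ hτ').dotProduct' (hx τ hτ')).const_mul c).sub
        (hS.hasDerivWithinAt_form hτ' (hSs τ hτ') (hx τ hτ')))
    (fun τ hτ => by
      have hτ' : τ ∈ Set.Icc a b := ⟨ht.1.trans hτ.1, hτ.2⟩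
      have h1 := hω τ hτ' (x τ)
      have h2 := hβ τ hτ' (x τ)
      have h3 := hγ τ hτ' (x τ)
      have h4 := isSymm_dotProduct_mulVec_comm (hGs τ hτ') (x τ) (S τ *ᵥ x τ)
      have h5 := dotProduct_self_nonneg' (x τ)
      rw [dotProduct_comm (N τ *ᵥ x τ)]
      simp only [hN, Matrix.sub_mulVec, Matrix.smul_mulVec, ← Matrix.mulVec_mulVec, dotProduct_sub,
        dotProduct_smul, smul_eq_mul, h4]
      have m1 := mul_le_mul_of_nonneg_left h2 (sq_nonneg c)
      have m2 := mul_le_mul_of_nonneg_left h1 hc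
      have m3 := mul_le_mul_of_nonneg_right hcγ h5
      generalize x τ ⬝ᵥ x τ = p at *
      generalize x τ ⬝ᵥ (F τ *ᵥ x τ) = q at *
      linarith)
  simp only [hxt] at key
  linarith [hb (x b)]

/-- Exponential decay of the closed loop from two-sided bounds on `S`. -/
theorem SolvesRiccati.closedLoop_norm_le (hF : ContinuousOn F (Set.Icc a b))
    (hG : ContinuousOn G (Set.Icc a b)) (hS : SolvesRiccati F G Q S a b)
    (hSs : ∀ t ∈ Set.Icc a b, (S t).IsSymm)
    (hG0 : ∀ t ∈ Set.Icc a b, ∀ x, 0 ≤ x ⬝ᵥ (G t *ᵥ x))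
    {γ c₀ c₁ : ℝ} (hγ0 : 0 ≤ γ) (h0 : 0 < c₀) (h1 : 0 < c₁)
    (hγ : ∀ t ∈ Set.Icc a b, ∀ x, γ * (x ⬝ᵥ x) ≤ x ⬝ᵥ (Q t *ᵥ x))
    (hl : ∀ t ∈ Set.Icc a b, ∀ x, c₀ * (x ⬝ᵥ x) ≤ x ⬝ᵥ (S t *ᵥ x))
    (hu : ∀ t ∈ Set.Icc a b, ∀ x, x ⬝ᵥ (S t *ᵥ x) ≤ c₁ * (x ⬝ᵥ x))
    {s t : ℝ} (hs : a ≤ s) (hst : s ≤ t) (ht : t ≤ b) :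
    ‖evolutionOperator (fun τ => F τ - G τ * S τ) t s‖ ≤
      Real.sqrt (c₁ / c₀) * Real.exp (-(γ / (2 * c₁)) * (t - s)) := by
  refine norm_le_of_mulVec_dotProduct_self_le (by positivity) fun v => ?_
  have hN : ContinuousOn (fun τ => F τ - G τ * S τ) (Set.Icc a b) :=
    hF.sub (hG.matrix_mul' hS.continuousOn)
  have hI : ∀ τ ∈ Set.Icc s t, τ ∈ Set.Icc a b := fun τ hτ => ⟨hs.trans hτ.1, hτ.2.trans ht⟩
  have hsI := hI s ⟨le_rfl, hst⟩
  set x : ℝ → Fin n → ℝ := fun τ => evolutionOperator (fun τ => F τ - G τ * S τ) τ s *ᵥ v with hx_def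
  have hx := fun τ hτ => evolutionOperator_mulVec_hasDerivWithinAt hN hsI (hI τ hτ) v
  -- Lyapunov step: `e^{(γ/c₁)(τ-s)} xᵀ S x` is nonincreasing. Passing from squared lengths to
  -- lengths later halves the rate `γ / c₁`.
  have key := le_of_hasDerivWithinAt_nonneg hs hst ht
    (f := fun τ => -(Real.exp (γ / c₁ * (τ - s)) * (x τ ⬝ᵥ (S τ *ᵥ x τ))))
    (fun τ hτ => ((hasDerivWithinAt_exp_mul_sub (γ / c₁) s).mul
      (hS.hasDerivWithinAt_form (hI τ hτ) (hSs τ (hI τ hτ)) (hx τ hτ))).neg)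
    (fun τ hτ => by
      have e1 := hG0 τ (hI τ hτ) (S τ *ᵥ x τ)
      have e2 := hγ τ (hI τ hτ) (x τ)
      have e3 : γ / c₁ * (x τ ⬝ᵥ (S τ *ᵥ x τ)) ≤ γ * (x τ ⬝ᵥ x τ) := by
        rw [div_mul_eq_mul_div, div_le_iff₀ h1, mul_assoc]
        exact mul_le_mul_of_nonneg_left ((hu τ (hI τ hτ) (x τ)).trans_eq (mul_comm _ _)) hγ0
      have e4 := Real.exp_pos (γ / c₁ * (τ - s))
      change 0 ≤ -(γ / c₁ * Real.exp (γ / c₁ * (τ - s)) * (x τ ⬝ᵥ (S τ *ᵥ x τ)) +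
        Real.exp (γ / c₁ * (τ - s)) * ((S τ *ᵥ x τ) ⬝ᵥ (G τ *ᵥ (S τ *ᵥ x τ)) -
          x τ ⬝ᵥ (Q τ *ᵥ x τ) + 2 * ((S τ *ᵥ x τ) ⬝ᵥ ((F τ - G τ * S τ) *ᵥ x τ - F τ *ᵥ x τ))))
      simp only [Matrix.sub_mulVec, ← Matrix.mulVec_mulVec, sub_sub_cancel_left, dotProduct_neg]
      nlinarith)
  have hxs : x s = v := by simp [hx_def, evolutionOperator_self]
  simp only [hxs, sub_self, mul_zero, Real.exp_zero, one_mul, neg_le_neg_iff] at key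
  have k1 := hl t (hI t ⟨hst, le_rfl⟩) (x t)
  have k2 := hu s hsI v
  have k3 : Real.exp (γ / c₁ * (t - s)) * (c₀ * (x t ⬝ᵥ x t)) ≤ c₁ * (v ⬝ᵥ v) :=
    (mul_le_mul_of_nonneg_left k1 (Real.exp_pos _).le).trans (key.trans k2)
  have k4 : Real.exp (-(γ / (2 * c₁)) * (t - s)) ^ 2 * Real.exp (γ / c₁ * (t - s)) = 1 := by
    rw [← Real.exp_nat_mul, ← Real.exp_add, Real.exp_eq_one_iff]
    push_cast
    field_simp
    ring
  rw [mul_pow, Real.sq_sqrt (by positivity)]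
  calc x t ⬝ᵥ x t = Real.exp (-(γ / (2 * c₁)) * (t - s)) ^ 2 / c₀ *
        (Real.exp (γ / c₁ * (t - s)) * (c₀ * (x t ⬝ᵥ x t))) := by
        generalize Real.exp (-(γ / (2 * c₁)) * (t - s)) = E at k4 ⊢
        generalize Real.exp (γ / c₁ * (t - s)) = E' at k4 ⊢
        field_simp
        linear_combination -(x t ⬝ᵥ x t) * k4
    _ ≤ Real.exp (-(γ / (2 * c₁)) * (t - s)) ^ 2 / c₀ * (c₁ * (v ⬝ᵥ v)) :=
        mul_le_mul_of_nonneg_left k3 (by positivity)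
    _ = _ := by ring

end Riccati

/-! ### Gramian forms and minimum energy steering -/

section Steering

variable {nx nu : ℕ} {a b : ℝ} {A : ℝ → Matrix (Fin nx) (Fin nx) ℝ}
  {B : ℝ → Matrix (Fin nx) (Fin nu) ℝ}

theorem gramian_form_hasDerivWithinAt (hA : ContinuousOn A (Set.Icc a b))
    (hB : ContinuousOn B (Set.Icc a b)) {s t : ℝ}
    (hs : s ∈ Set.Icc a b) (ht : t ∈ Set.Icc a b) (y z : Fin nx → ℝ) :
    HasDerivWithinAt (fun t => y ⬝ᵥ (gramian A B s t *ᵥ z))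
      (((B t)ᵀ *ᵥ ((evolutionOperator A s t)ᵀ *ᵥ y)) ⬝ᵥ
        ((B t)ᵀ *ᵥ ((evolutionOperator A s t)ᵀ *ᵥ z))) (Set.Icc a b) t := by
  refine ((hasDerivWithinAt_const t (Set.Icc a b) y).dotProduct'
    ((gramian_hasDerivWithinAt hA hB hs ht).mulVec_const' z)).congr_deriv ?_
  simp only [zero_dotProduct, zero_add, ← Matrix.mulVec_mulVec, mulVec_dotProduct_eq,
    Matrix.transpose_transpose]

/-- Both sides vanish at `t = s` and have the same derivative in `t`. -/
theorem gramian_form_comm (hA : ContinuousOn A (Set.Icc a b))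
    (hB : ContinuousOn B (Set.Icc a b)) {s t : ℝ} (hs : a ≤ s) (hst : s ≤ t) (ht : t ≤ b)
    (y z : Fin nx → ℝ) : y ⬝ᵥ (gramian A B s t *ᵥ z) = z ⬝ᵥ (gramian A B s t *ᵥ y) := by
  have hI : ∀ τ ∈ Set.Icc s t, τ ∈ Set.Icc a b := fun τ hτ => ⟨hs.trans hτ.1, hτ.2.trans ht⟩
  have key : ∀ y z : Fin nx → ℝ,
      z ⬝ᵥ (gramian A B s t *ᵥ y) ≤ y ⬝ᵥ (gramian A B s t *ᵥ z) := fun y z => by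
    have := le_of_hasDerivWithinAt_nonneg hs hst ht
      (fun τ hτ => (gramian_form_hasDerivWithinAt hA hB (hI s ⟨le_rfl, hst⟩) (hI τ hτ) y z).sub
        (gramian_form_hasDerivWithinAt hA hB (hI s ⟨le_rfl, hst⟩) (hI τ hτ) z y))
      (fun _ _ => by rw [dotProduct_comm, sub_self])
    simpa [gramian_self] using this
  exact (key z y).antisymm (key y z)

theorem gramian_form_mono (hA : ContinuousOn A (Set.Icc a b))
    (hB : ContinuousOn B (Set.Icc a b)) {r s t : ℝ} (hr : a ≤ r) (hrs : r ≤ s) (hst : s ≤ t)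
    (ht : t ≤ b) (z : Fin nx → ℝ) :
    z ⬝ᵥ (gramian A B r s *ᵥ z) ≤ z ⬝ᵥ (gramian A B r t *ᵥ z) :=
  le_of_hasDerivWithinAt_nonneg (hr.trans hrs) hst ht
    (fun _ hτ => gramian_form_hasDerivWithinAt hA hB ⟨hr, (hrs.trans hst).trans ht⟩
      ⟨(hr.trans hrs).trans hτ.1, hτ.2.trans ht⟩ z z) (fun _ _ => dotProduct_self_nonneg' _)

theorem gramian_form_nonneg (hA : ContinuousOn A (Set.Icc a b))
    (hB : ContinuousOn B (Set.Icc a b)) {s t : ℝ} (hs : a ≤ s) (hst : s ≤ t) (ht : t ≤ b)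
    (z : Fin nx → ℝ) : 0 ≤ z ⬝ᵥ (gramian A B s t *ᵥ z) := by
  simpa [gramian_self] using gramian_form_mono hA hB hs le_rfl hst ht z

/-- The integrand is at most `λ_B² e^{2c(τ-s)} |z|²`, whose antiderivative is compared with the
form. Any bound `c` of `‖A‖` is allowed, so `ω ≥ λ_A` can be inserted. -/
theorem gramian_form_le (hA : ContinuousOn A (Set.Icc a b))
    (hB : ContinuousOn B (Set.Icc a b)) {c lamB : ℝ} (hc0 : 0 < c)
    (hc : ∀ t ∈ Set.Icc a b, ‖A t‖ ≤ c) (hlamB : ∀ t ∈ Set.Icc a b, ‖B t‖ ≤ lamB)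
    {s t : ℝ} (hs : a ≤ s) (hst : s ≤ t) (ht : t ≤ b) (z : Fin nx → ℝ) :
    z ⬝ᵥ (gramian A B s t *ᵥ z) ≤
      lamB ^ 2 * (Real.exp (2 * c * (t - s)) - 1) / (2 * c) * (z ⬝ᵥ z) := by
  have hI : ∀ τ ∈ Set.Icc s t, τ ∈ Set.Icc a b := fun τ hτ => ⟨hs.trans hτ.1, hτ.2.trans ht⟩
  have key := le_of_hasDerivWithinAt_nonneg hs hst ht
    (f := fun τ => lamB ^ 2 / (2 * c) * (z ⬝ᵥ z) * Real.exp (2 * c * (τ - s)) -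
      z ⬝ᵥ (gramian A B s τ *ᵥ z))
    (fun τ hτ => ((hasDerivWithinAt_exp_mul_sub (2 * c) s).const_mul
        (lamB ^ 2 / (2 * c) * (z ⬝ᵥ z))).sub
      (gramian_form_hasDerivWithinAt hA hB (hI s ⟨le_rfl, hst⟩) (hI τ hτ) z z))
    (fun τ hτ => by
      have h1 := mulVec_dotProduct_self_le
        ((norm_transpose_eq (B τ)).trans_le (hlamB τ (hI τ hτ)))
        ((evolutionOperator A s τ)ᵀ *ᵥ z)
      have h2 := mulVec_dotProduct_self_le
        (evolutionOperator_transpose_norm_le hA hc hs hτ.1 (hτ.2.trans ht)) z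
      rw [← Real.exp_nat_mul] at h2
      have h3 := h1.trans (mul_le_mul_of_nonneg_left h2 (sq_nonneg lamB))
      rw [sub_nonneg]
      refine h3.trans_eq ?_
      push_cast
      field_simp)
  simp only [gramian_self, sub_self, mul_zero, Real.exp_zero, Matrix.zero_mulVec,
    dotProduct_zero] at key
  have : lamB ^ 2 * (Real.exp (2 * c * (t - s)) - 1) / (2 * c) * (z ⬝ᵥ z) =
    lamB ^ 2 / (2 * c) * (z ⬝ᵥ z) * Real.exp (2 * c * (t - s)) -
      lamB ^ 2 / (2 * c) * (z ⬝ᵥ z) * 1 := by ring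
  linarith

/-- Steering a state to the origin with a minimum energy control; `E` is the energy spent. -/
theorem exists_steering (hA : ContinuousOn A (Set.Icc a b))
    (hB : ContinuousOn B (Set.Icc a b)) {lamA α₀ : ℝ} (hlamA : ∀ t ∈ Set.Icc a b, ‖A t‖ ≤ lamA)
    {s t : ℝ} (hs : a ≤ s) (hst : s ≤ t) (ht : t ≤ b) (hα₀ : 0 < α₀)
    (hW : ∀ z, α₀ * (z ⬝ᵥ z) ≤ z ⬝ᵥ (gramian A B s t *ᵥ z)) (x₀ : Fin nx → ℝ) :
    ∃ (x : ℝ → Fin nx → ℝ) (u : ℝ → Fin nu → ℝ) (E : ℝ → ℝ),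
      (∀ τ ∈ Set.Icc a b, HasDerivWithinAt x (A τ *ᵥ x τ + B τ *ᵥ u τ) (Set.Icc a b) τ) ∧
      x s = x₀ ∧ x t = 0 ∧
      (∀ τ ∈ Set.Icc a b, HasDerivWithinAt E (u τ ⬝ᵥ u τ) (Set.Icc a b) τ) ∧
      E s = 0 ∧ E t ≤ 1 / α₀ * (x₀ ⬝ᵥ x₀) ∧
      ∀ α, 0 < α → (∀ z, z ⬝ᵥ (gramian A B s t *ᵥ z) ≤ α * (z ⬝ᵥ z)) → ∀ τ ∈ Set.Icc s t,
        x τ ⬝ᵥ x τ ≤ Real.exp (2 * lamA * (τ - s)) * ((1 + α / α₀) ^ 2 * (x₀ ⬝ᵥ x₀)) := by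
  have hsI : s ∈ Set.Icc a b := ⟨hs, hst.trans ht⟩
  have hu := isUnit_det_of_coercive hα₀ hW
  obtain ⟨-, hη1, hη2⟩ := inv_coercive_bounds hα₀ hW x₀
  set η := (gramian A B s t)⁻¹ *ᵥ x₀ with hη
  have hWη : gramian A B s t *ᵥ η = x₀ := by
    rw [hη, Matrix.mulVec_mulVec, Matrix.mul_nonsing_inv _ hu, Matrix.one_mulVec]
  -- Variation of constants for `u(τ) = -B(τ)ᵀ Φ(s, τ)ᵀ η` with `W(s, t) η = x₀`: the state reaches
  -- `0` at `t`, and the energy up to `τ` is `η ⬝ᵥ W(s, τ) η`.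
  refine ⟨fun τ => evolutionOperator A τ s *ᵥ (x₀ - gramian A B s τ *ᵥ η),
    fun τ => -((B τ)ᵀ *ᵥ ((evolutionOperator A s τ)ᵀ *ᵥ η)),
    fun τ => η ⬝ᵥ (gramian A B s τ *ᵥ η), fun τ hτ => ?_, ?_, ?_, fun τ hτ => ?_, ?_, ?_, ?_⟩
  · refine ((evolutionOperator_hasDerivWithinAt hA hsI hτ).mulVec'
      (((gramian_hasDerivWithinAt hA hB hsI hτ).mulVec_const' η).const_sub x₀)).congr_deriv ?_
    have e := evolutionOperator_mul_swap hA hsI hτ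
    rw [← Matrix.mulVec_mulVec, Matrix.mulVec_neg, Matrix.mulVec_neg]
    simp only [Matrix.mulVec_mulVec, Matrix.mul_assoc]
    rw [← Matrix.mul_assoc (evolutionOperator A τ s), e, Matrix.one_mul]
  · simp [gramian_self, evolutionOperator_self]
  · simp [hWη]
  · simpa using gramian_form_hasDerivWithinAt hA hB hsI hτ η η
  · simp [gramian_self]
  · simp only [hWη]
    rwa [dotProduct_comm]
  · intro α hα hWα τ hτ
    refine (evolutionOperator_forward_le hA hlamA hs hτ.1 (hτ.2.trans ht) _).trans
      (mul_le_mul_of_nonneg_left ?_ (Real.exp_pos _).le)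
    refine sub_dotProduct_sub_le (by positivity) le_rfl ?_
    -- Since `0 ≤ W(s, τ) ≤ W(s, t) ≤ α I`, one has `|W(s, τ) η| ≤ α |η| ≤ (α / α₀) |x₀|`. Keeping
    -- `α` free permits two different upper bounds later.
    have h1 := mulVec_dotProduct_self_le_of_form_le
      (gramian_form_comm hA hB hs hτ.1 (hτ.2.trans ht)) hα
      (gramian_form_nonneg hA hB hs hτ.1 (hτ.2.trans ht))
      (fun z => (gramian_form_mono hA hB hs hτ.1 hτ.2 ht z).trans (hWα z)) η
    refine h1.trans ((mul_le_mul_of_nonneg_left hη2 (sq_nonneg α)).trans_eq (by ring))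

end Steering

/-! ### Completing the square in the input -/

section CompletionOfSquares

variable {n : ℕ} {R : Matrix (Fin n) (Fin n) ℝ} {γ : ℝ}

/-- Expand `0 ≤ (R⁻¹ w + v) ⬝ᵥ R (R⁻¹ w + v)`. With `w = Bᵀ S x` this says that no input beats the
optimal feedback. -/
theorem neg_form_le_completion (hR : R.IsSymm) (hγ : 0 < γ)
    (h : ∀ x, γ * (x ⬝ᵥ x) ≤ x ⬝ᵥ (R *ᵥ x)) (v w : Fin n → ℝ) :
    -(v ⬝ᵥ (R *ᵥ v)) ≤ w ⬝ᵥ (R⁻¹ *ᵥ w) + 2 * (w ⬝ᵥ v) := by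
  have hu := isUnit_det_of_coercive hγ h
  have h1 := (mul_nonneg hγ.le (dotProduct_self_nonneg' (R⁻¹ *ᵥ w + v))).trans (h (R⁻¹ *ᵥ w + v))
  have h2 : R *ᵥ (R⁻¹ *ᵥ w) = w := by
    rw [Matrix.mulVec_mulVec, Matrix.mul_nonsing_inv _ hu, Matrix.one_mulVec]
  have h3 := isSymm_dotProduct_mulVec_comm hR v (R⁻¹ *ᵥ w)
  rw [h2] at h3
  simp only [Matrix.mulVec_add, add_dotProduct, dotProduct_add, h2, ← h3] at h1
  rw [dotProduct_comm (R⁻¹ *ᵥ w) w, dotProduct_comm v w] at h1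
  linarith

end CompletionOfSquares

/-! ### The reduced data without cross term, and their bounds -/

namespace Problem

variable {nx nu : ℕ} (P : Problem nx nu) {k : Constants}

/-- The drift `A - B R⁻¹ H` after elimination of the cross term. -/
noncomputable def drift (t : ℝ) : Matrix (Fin nx) (Fin nx) ℝ :=
  P.A t - P.B t * (P.R t)⁻¹ * P.H t

/-- The quadratic coefficient `B R⁻¹ Bᵀ` of the Riccati equation. -/
noncomputable def inputWeight (t : ℝ) : Matrix (Fin nx) (Fin nx) ℝ :=
  P.B t * (P.R t)⁻¹ * (P.B t)ᵀ

/-- The state weight `Q - Hᵀ R⁻¹ H` after elimination of the cross term. -/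
noncomputable def stateWeight (t : ℝ) : Matrix (Fin nx) (Fin nx) ℝ :=
  P.Q t - (P.H t)ᵀ * (P.R t)⁻¹ * P.H t

variable {P}

theorem isRiccatiSolution_iff {S : ℝ → Matrix (Fin nx) (Fin nx) ℝ} :
    P.IsRiccatiSolution S ↔
      SolvesRiccati P.drift P.inputWeight P.stateWeight S 0 P.T ∧ S P.T = P.QT := by
  have e : ∀ t, S t * P.B t * (P.R t)⁻¹ * (P.B t)ᵀ * S t = S t * P.inputWeight t * S t := fun t => by
    simp only [inputWeight, Matrix.mul_assoc]
  constructor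
  · rintro ⟨h1, h2⟩
    refine ⟨fun t ht => ?_, h2⟩
    have := h1 t ht
    rwa [e] at this
  · rintro ⟨h1, h2⟩
    refine ⟨fun t ht => ?_, h2⟩
    rw [e]
    exact h1 t ht

theorem closedLoop_eq (S : ℝ → Matrix (Fin nx) (Fin nx) ℝ) :
    P.closedLoop S = fun t => P.drift t - P.inputWeight t * S t := rfl

theorem IsCoercive.R_form_le (hc : P.IsCoercive k) {t : ℝ} (ht : t ∈ Set.Icc 0 P.T)
    (x : Fin nu → ℝ) : k.γR * (x ⬝ᵥ x) ≤ x ⬝ᵥ (P.R t *ᵥ x) :=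
  (smul_one_le_iff.1 (hc.le_R t ht)).2 x

theorem IsCoercive.isUnit_R (hc : P.IsCoercive k) {t : ℝ} (ht : t ∈ Set.Icc 0 P.T) :
    IsUnit (P.R t) :=
  (Matrix.isUnit_iff_isUnit_det _).2 (isUnit_det_of_coercive hc.γR_pos (hc.R_form_le ht))

theorem IsCoercive.inv_R_isSymm (hc : P.IsCoercive k) {t : ℝ} (ht : t ∈ Set.Icc 0 P.T) :
    ((P.R t)⁻¹).IsSymm := by
  rw [Matrix.IsSymm, Matrix.transpose_nonsing_inv, (hc.symm_R t ht).eq]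

theorem IsCoercive.norm_inv_R_le (hc : P.IsCoercive k) {t : ℝ} (ht : t ∈ Set.Icc 0 P.T) :
    ‖(P.R t)⁻¹‖ ≤ 1 / k.γR :=
  norm_le_of_mulVec_dotProduct_self_le (one_div_pos.2 hc.γR_pos).le fun x =>
    (inv_coercive_bounds hc.γR_pos (hc.R_form_le ht) x).2.2

theorem IsCoercive.inv_R_continuousOn (hc : P.IsCoercive k) (hb : P.IsBounded k) :
    ContinuousOn (fun t => (P.R t)⁻¹) (Set.Icc 0 P.T) :=
  hb.continuousOn_R.matrix_inv' fun _ ht => hc.isUnit_R ht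

theorem IsCoercive.drift_continuousOn (hc : P.IsCoercive k) (hb : P.IsBounded k) :
    ContinuousOn P.drift (Set.Icc 0 P.T) :=
  hb.continuousOn_A.sub
    ((hb.continuousOn_B.matrix_mul' (hc.inv_R_continuousOn hb)).matrix_mul' hb.continuousOn_H)

theorem IsCoercive.inputWeight_continuousOn (hc : P.IsCoercive k) (hb : P.IsBounded k) :
    ContinuousOn P.inputWeight (Set.Icc 0 P.T) :=
  (hb.continuousOn_B.matrix_mul' (hc.inv_R_continuousOn hb)).matrix_mul'
    hb.continuousOn_B.matrix_transpose'

theorem IsCoercive.stateWeight_continuousOn (hc : P.IsCoercive k) (hb : P.IsBounded k) :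
    ContinuousOn P.stateWeight (Set.Icc 0 P.T) :=
  hb.continuousOn_Q.sub ((hb.continuousOn_H.matrix_transpose'.matrix_mul'
    (hc.inv_R_continuousOn hb)).matrix_mul' hb.continuousOn_H)

theorem IsCoercive.norm_drift_le (hc : P.IsCoercive k) (hb : P.IsBounded k) {t : ℝ}
    (ht : t ∈ Set.Icc 0 P.T) : ‖P.drift t‖ ≤ k.ω := by
  have hγ := hc.γR_pos
  have h1 := hb.norm_B_le t ht
  have h2 := hc.norm_inv_R_le ht
  have h3 := hb.norm_H_le t ht
  refine (norm_sub_le _ _).trans (add_le_add (hb.norm_A_le t ht) ?_)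
  calc ‖P.B t * (P.R t)⁻¹ * P.H t‖ ≤ ‖P.B t‖ * ‖(P.R t)⁻¹‖ * ‖P.H t‖ :=
        (Matrix.l2_opNorm_mul _ _).trans
          (mul_le_mul_of_nonneg_right (Matrix.l2_opNorm_mul _ _) (norm_nonneg _))
    _ ≤ k.lamB * (1 / k.γR) * k.lamH := by
        have := hb.lamB_pos
        gcongr
    _ = _ := by ring

theorem inputWeight_form_eq (t : ℝ) (x : Fin nx → ℝ) :
    x ⬝ᵥ (P.inputWeight t *ᵥ x) = ((P.B t)ᵀ *ᵥ x) ⬝ᵥ ((P.R t)⁻¹ *ᵥ ((P.B t)ᵀ *ᵥ x)) := by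
  rw [mulVec_dotProduct_eq, Matrix.transpose_transpose, inputWeight]
  simp only [Matrix.mulVec_mulVec, Matrix.mul_assoc]

theorem stateWeight_form_eq (t : ℝ) (x : Fin nx → ℝ) : x ⬝ᵥ (P.stateWeight t *ᵥ x) =
    x ⬝ᵥ (P.Q t *ᵥ x) - (P.H t *ᵥ x) ⬝ᵥ ((P.R t)⁻¹ *ᵥ (P.H t *ᵥ x)) := by
  rw [mulVec_dotProduct_eq, stateWeight, Matrix.sub_mulVec, dotProduct_sub]
  simp only [Matrix.mulVec_mulVec, Matrix.mul_assoc]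

theorem IsCoercive.inputWeight_isSymm (hc : P.IsCoercive k) {t : ℝ} (ht : t ∈ Set.Icc 0 P.T) :
    (P.inputWeight t).IsSymm := by
  rw [Matrix.IsSymm, inputWeight]
  simp only [Matrix.transpose_mul, Matrix.transpose_transpose, (hc.inv_R_isSymm ht).eq,
    Matrix.mul_assoc]

theorem IsCoercive.inputWeight_form_nonneg (hc : P.IsCoercive k) {t : ℝ}
    (ht : t ∈ Set.Icc 0 P.T) (x : Fin nx → ℝ) : 0 ≤ x ⬝ᵥ (P.inputWeight t *ᵥ x) := by
  rw [inputWeight_form_eq]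
  exact (inv_coercive_bounds hc.γR_pos (hc.R_form_le ht) _).1

theorem IsCoercive.inputWeight_form_le (hc : P.IsCoercive k) (hb : P.IsBounded k) {t : ℝ}
    (ht : t ∈ Set.Icc 0 P.T) (x : Fin nx → ℝ) :
    x ⬝ᵥ (P.inputWeight t *ᵥ x) ≤ k.lamB ^ 2 / k.γR * (x ⬝ᵥ x) := by
  rw [inputWeight_form_eq]
  refine (inv_coercive_bounds hc.γR_pos (hc.R_form_le ht) _).2.1.trans ?_
  have := mulVec_dotProduct_self_le ((norm_transpose_eq (P.B t)).trans_le (hb.norm_B_le t ht)) x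
  exact (mul_le_mul_of_nonneg_left this (one_div_pos.2 hc.γR_pos).le).trans_eq (by ring)

theorem IsCoercive.stateWeight_isSymm (hc : P.IsCoercive k) {t : ℝ} (ht : t ∈ Set.Icc 0 P.T) :
    (P.stateWeight t).IsSymm := (smul_one_le_iff.1 (hc.le_Q t ht)).1

theorem IsCoercive.le_stateWeight_form (hc : P.IsCoercive k) {t : ℝ} (ht : t ∈ Set.Icc 0 P.T)
    (x : Fin nx → ℝ) : k.γQ * (x ⬝ᵥ x) ≤ x ⬝ᵥ (P.stateWeight t *ᵥ x) :=
  (smul_one_le_iff.1 (hc.le_Q t ht)).2 x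

theorem IsCoercive.stateWeight_form_le (hc : P.IsCoercive k) (hb : P.IsBounded k) {t : ℝ}
    (ht : t ∈ Set.Icc 0 P.T) (x : Fin nx → ℝ) :
    x ⬝ᵥ (P.stateWeight t *ᵥ x) ≤ k.lamQ * (x ⬝ᵥ x) := by
  rw [stateWeight_form_eq]
  have h1 := (inv_coercive_bounds hc.γR_pos (hc.R_form_le ht) (P.H t *ᵥ x)).1
  have h2 := (abs_le.1 (abs_dotProduct_mulVec_le (hb.norm_Q_le t ht) x)).2
  linarith

theorem IsBounded.ω_pos (hb : P.IsBounded k) (hc : P.IsCoercive k) : 0 < k.ω := by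
  have h1 := hb.lamA_pos
  have h2 := hb.lamB_pos
  have h3 := hb.lamH_pos
  have h4 := hc.γR_pos
  unfold Constants.ω
  positivity

theorem IsBounded.lamA_le_ω (hb : P.IsBounded k) (hc : P.IsCoercive k) : k.lamA ≤ k.ω := by
  have h2 := hb.lamB_pos
  have h3 := hb.lamH_pos
  have h4 := hc.γR_pos
  exact le_add_of_nonneg_right (by positivity)

/-! ### Bounds for the constants -/

theorem IsBounded.c₁_pos (hb : P.IsBounded k) (hc : P.IsCoercive k) : 0 < k.c₁ := by
  have h1 := hb.ω_pos hc
  have h2 := hb.lamQ_pos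
  have h4 := hc.γR_pos
  exact mul_pos (lt_max_of_lt_right (by positivity)) (Real.exp_pos _)

theorem IsBounded.αt₀_pos (hb : P.IsBounded k) (hc : P.IsCoercive k) (hu : P.IsUCC k) :
    0 < k.αt₀ := by
  have h1 := hb.ω_pos hc
  have h2 : Real.exp (-2 * k.ω * k.σ) < 1 := Real.exp_lt_one_iff.2 (by nlinarith [hu.σ_pos])
  have h3 : 0 < 1 - Real.exp (-2 * k.ω * k.σ) := sub_pos.2 h2
  unfold Constants.αt₀
  positivity

theorem IsBounded.αt₁_pos (hb : P.IsBounded k) (hc : P.IsCoercive k) (hu : P.IsUCC k) :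
    0 < k.αt₁ := by
  have h1 := hb.ω_pos hc
  have h0 := hu.σ_pos
  have h2 : 1 < Real.exp (2 * k.ω * k.σ) := Real.one_lt_exp_iff.2 (by positivity)
  have h3 := sub_pos.2 h2
  unfold Constants.αt₁
  positivity

/-- The last two bounds are what the comparison argument needs: `c₀ I` lies below `Q_T` and is a
subsolution. Both summands of the quadratic condition turn out to be at most `γ_Q / 2`. -/
theorem IsBounded.c₀_bounds (hb : P.IsBounded k) (hc : P.IsCoercive k) (hu : P.IsUCC k) :
    0 < k.c₀ ∧ k.c₀ ≤ k.γQ ∧ 2 * k.ω * k.c₀ + k.lamB ^ 2 / k.γR * k.c₀ ^ 2 ≤ k.γQ := by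
  have h1 := hb.ω_pos hc
  have h2 := hb.αt₀_pos hc hu
  have h3 := hb.αt₁_pos hc hu
  have h4 := hc.γR_pos
  have h5 := hc.γQ_pos
  have h6 := hb.lamB_pos
  have e0 : k.αt₀ = 1 / (2 * k.ω) * (1 - Real.exp (-2 * k.ω * k.σ)) := rfl
  have hy0 : 0 < Real.exp (-2 * k.ω * k.σ) := Real.exp_pos _
  have hy1 : Real.exp (-2 * k.ω * k.σ) < 1 := Real.exp_lt_one_iff.2 (by nlinarith [hu.σ_pos])
  unfold Constants.c₀
  generalize Real.exp (-2 * k.ω * k.σ) = y at *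
  set β := k.lamB ^ 2 / k.γR with hβ
  have hβ0 : 0 < β := by positivity
  set q := β * (1 + k.αt₁ / k.αt₀) ^ 2 with hq
  have hq1 : β ≤ q := le_mul_of_one_le_right hβ0.le
    (one_le_pow₀ (le_add_of_nonneg_right (by positivity)))
  set p := 1 / (k.γQ * k.αt₀ ^ 2) with hp
  have hp0 : 0 < p := by positivity
  set c := min (2 * k.ω * (q + p)⁻¹) ((k.lamB ^ 2 / (2 * k.γR * k.ω) + 1 / k.γQ)⁻¹) * y with hcdef
  have hq0 : 0 < q := hβ0.trans_le hq1
  have hc0 : 0 < c := mul_pos (lt_min (by positivity) (by positivity)) hy0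
  have hcD : c * (q + p) ≤ 2 * k.ω * y := by
    have : c ≤ 2 * k.ω * (q + p)⁻¹ * y := mul_le_mul_of_nonneg_right (min_le_left _ _) hy0.le
    calc c * (q + p) ≤ 2 * k.ω * (q + p)⁻¹ * y * (q + p) :=
          mul_le_mul_of_nonneg_right this (by positivity)
      _ = 2 * k.ω * y := by field_simp
  -- Hence `β c² ≤ 2 ω c`, so it remains to bound `2 ω c` by `γ_Q / 2`.
  have hcβ : β * c ≤ 2 * k.ω := by nlinarith
  have hcp : c * p ≤ 2 * k.ω * y := by nlinarith
  -- The factor `(1 - y)²` comes from `α̃₀ = (1 - y) / (2 ω)`, and the remaining `y` from the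
  -- exponential in `c₀`.
  have hc2 : 2 * k.ω * c ≤ k.γQ * (y * (1 - y) ^ 2) := by
    have : 2 * k.ω * c = 2 * k.ω * (k.γQ * k.αt₀ ^ 2) * (c * p) := by
      rw [hp]
      field_simp
    rw [this]
    refine (mul_le_mul_of_nonneg_left hcp (by positivity)).trans_eq ?_
    rw [e0]
    field_simp
  have hy2 : y * (1 - y) ^ 2 ≤ 1 / 2 := by nlinarith [sq_nonneg (y - 1 / 2), sq_nonneg (1 - y)]
  have hc3 : 2 * k.ω * c ≤ k.γQ / 2 := by nlinarith
  refine ⟨hc0, ?_, by nlinarith⟩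
  have h7 : (k.lamB ^ 2 / (2 * k.γR * k.ω) + 1 / k.γQ)⁻¹ ≤ k.γQ :=
    inv_le_of_inv_le₀ h5 (by rw [← one_div]; exact le_add_of_nonneg_left (by positivity))
  calc c ≤ k.γQ * 1 := mul_le_mul ((min_le_right _ _).trans h7) hy1.le hy0.le h5.le
    _ = k.γQ := mul_one _

theorem IsBounded.α₁'_pos (hb : P.IsBounded k) (hc : P.IsCoercive k) (hu : P.IsUCC k) :
    0 < k.α₁' := by
  have h1 := hb.ω_pos hc
  have h0 := hu.σ_pos
  have h2 : 1 < Real.exp (2 * k.σ * k.ω) := Real.one_lt_exp_iff.2 (by positivity)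
  have h3 := sub_pos.2 h2
  have h6 := hb.lamB_pos
  unfold Constants.α₁'
  positivity

end Problem

/-! ### Two-sided bounds for the Riccati solution of the control problem -/

namespace Problem

variable {nx nu : ℕ} {P : Problem nx nu} {k : Constants}
  {S : ℝ → Matrix (Fin nx) (Fin nx) ℝ}

theorem IsCoercive.exists_isRiccatiSolution (hc : P.IsCoercive k) (hb : P.IsBounded k)
    (hT : 0 ≤ P.T) : ∃ S, P.IsRiccatiSolution S := by
  obtain ⟨S, hS⟩ := exists_solvesRiccati hT (hc.drift_continuousOn hb)
    (hc.inputWeight_continuousOn hb) (hc.stateWeight_continuousOn hb)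
    (fun t ht x => hc.inputWeight_form_nonneg ht x)
    (fun t ht x => (mul_nonneg hc.γQ_pos.le (dotProduct_self_nonneg' x)).trans
      (hc.le_stateWeight_form ht x)) hc.γQ_pos (smul_one_le_iff.1 hc.le_QT).2
  exact ⟨S, isRiccatiSolution_iff.2 hS⟩

theorem IsRiccatiSolution.eqOn {S' : ℝ → Matrix (Fin nx) (Fin nx) ℝ} (hS : P.IsRiccatiSolution S)
    (hc : P.IsCoercive k) (hb : P.IsBounded k) (hS' : P.IsRiccatiSolution S') :
    Set.EqOn S' S (Set.Icc 0 P.T) :=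
  SolvesRiccati.eqOn (hc.drift_continuousOn hb) (hc.inputWeight_continuousOn hb)
    (isRiccatiSolution_iff.1 hS').1 (isRiccatiSolution_iff.1 hS).1
    (hS'.terminal.trans hS.terminal.symm)

theorem IsRiccatiSolution.isSymm (hS : P.IsRiccatiSolution S) (hc : P.IsCoercive k)
    (hb : P.IsBounded k) {t : ℝ} (ht : t ∈ Set.Icc 0 P.T) : (S t).IsSymm :=
  SolvesRiccati.isSymm (hc.drift_continuousOn hb) (hc.inputWeight_continuousOn hb)
    (fun _ h => hc.inputWeight_isSymm h) (fun _ h => hc.stateWeight_isSymm h)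
    (isRiccatiSolution_iff.1 hS).1 (hS.terminal ▸ hc.symm_QT) ht

theorem IsRiccatiSolution.c₀_le_form (hS : P.IsRiccatiSolution S) (hc : P.IsCoercive k)
    (hb : P.IsBounded k) (hu : P.IsUCC k) {t : ℝ} (ht : t ∈ Set.Icc 0 P.T) (v : Fin nx → ℝ) :
    k.c₀ * (v ⬝ᵥ v) ≤ v ⬝ᵥ (S t *ᵥ v) := by
  obtain ⟨h0, h1, h2⟩ := hb.c₀_bounds hc hu
  refine SolvesRiccati.le_form (hc.drift_continuousOn hb) (hc.inputWeight_continuousOn hb)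
    (fun _ h => hc.inputWeight_isSymm h) (isRiccatiSolution_iff.1 hS).1
    (fun _ h => hS.isSymm hc hb h) h0.le
    (fun τ h x => (abs_le.1 (abs_dotProduct_mulVec_le (hc.norm_drift_le hb h) x)).1)
    (fun _ h x => hc.inputWeight_form_le hb h x) (fun _ h x => hc.le_stateWeight_form h x) h2
    (fun x => ?_) ht v
  rw [hS.terminal]
  exact (mul_le_mul_of_nonneg_right h1 (dotProduct_self_nonneg' x)).trans
    ((smul_one_le_iff.1 hc.le_QT).2 x)

/-- Upper bound for `S(t)` near the terminal time, from the zero control. -/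
theorem IsRiccatiSolution.form_le_of_free (hS : P.IsRiccatiSolution S) (hc : P.IsCoercive k)
    (hb : P.IsBounded k) {t : ℝ} (ht : t ∈ Set.Icc 0 P.T) (v : Fin nx → ℝ) :
    v ⬝ᵥ (S t *ᵥ v) ≤ k.lamQ * (1 + 1 / (2 * k.ω)) * Real.exp (2 * k.ω * (P.T - t)) * (v ⬝ᵥ v) := by
  have hω := hb.ω_pos hc
  have hlam := hb.lamQ_pos
  obtain ⟨x, hx, hxt⟩ := exists_linear_solution (hc.drift_continuousOn hb) ht v
  have hI : ∀ τ ∈ Set.Icc t P.T, τ ∈ Set.Icc 0 P.T := fun τ hτ => ⟨ht.1.trans hτ.1, hτ.2⟩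
  have hgr : ∀ τ ∈ Set.Icc t P.T, x τ ⬝ᵥ x τ ≤ Real.exp (2 * k.ω * (τ - t)) * (v ⬝ᵥ v) := by
    intro τ hτ
    rw [← hxt]
    exact dotProduct_self_le_exp ht.1 hτ.1 hτ.2
      (fun r hr => hx r (hI r ⟨hr.1, hr.2.trans hτ.2⟩)) fun r hr =>
        (abs_le.1 (abs_dotProduct_mulVec_le
          (hc.norm_drift_le hb (hI r ⟨hr.1, hr.2.trans hτ.2⟩)) _)).2
  -- Along `ẋ = F x` the form loses at most `λ_Q |x|²` per unit time; the added exponential is an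
  -- antiderivative of the bound of this loss.
  have key := le_of_hasDerivWithinAt_nonneg ht.1 ht.2 le_rfl
    (f := fun τ => x τ ⬝ᵥ (S τ *ᵥ x τ) +
      k.lamQ * (v ⬝ᵥ v) / (2 * k.ω) * Real.exp (2 * k.ω * (τ - t)))
    (fun τ hτ => ((isRiccatiSolution_iff.1 hS).1.hasDerivWithinAt_form (hI τ hτ)
      (hS.isSymm hc hb (hI τ hτ)) (hx τ (hI τ hτ))).add
        ((hasDerivWithinAt_exp_mul_sub (2 * k.ω) t).const_mul _))
    (fun τ hτ => by
      have h1 := hc.inputWeight_form_nonneg (hI τ hτ) (S τ *ᵥ x τ)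
      have h2 := hc.stateWeight_form_le hb (hI τ hτ) (x τ)
      have h3 := mul_le_mul_of_nonneg_left (hgr τ hτ) hlam.le
      have h4 : k.lamQ * (v ⬝ᵥ v) / (2 * k.ω) * (2 * k.ω * Real.exp (2 * k.ω * (τ - t))) =
        k.lamQ * (Real.exp (2 * k.ω * (τ - t)) * (v ⬝ᵥ v)) := by field_simp
      rw [sub_self, dotProduct_zero, h4]
      linarith)
  simp only [hxt, sub_self, mul_zero, Real.exp_zero, mul_one, hS.terminal] at key
  have h1 := (le_smul_one_iff.1 hc.QT_le).2 (x P.T)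
  have h2 := mul_le_mul_of_nonneg_left (hgr P.T ⟨ht.2, le_rfl⟩) hlam.le
  have h3 : 0 ≤ k.lamQ * (v ⬝ᵥ v) / (2 * k.ω) :=
    div_nonneg (mul_nonneg hlam.le (dotProduct_self_nonneg' v)) (by positivity)
  have h4 : k.lamQ * (1 + 1 / (2 * k.ω)) * Real.exp (2 * k.ω * (P.T - t)) * (v ⬝ᵥ v) =
    k.lamQ * (Real.exp (2 * k.ω * (P.T - t)) * (v ⬝ᵥ v)) +
      k.lamQ * (v ⬝ᵥ v) / (2 * k.ω) * Real.exp (2 * k.ω * (P.T - t)) := by ring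
  linarith

/-- Lower bound for the derivative of `xᵀ S x` along a controlled trajectory. -/
theorem IsRiccatiSolution.exists_form_hasDerivWithinAt (hS : P.IsRiccatiSolution S)
    (hc : P.IsCoercive k) (hb : P.IsBounded k) {t : ℝ} (ht : t ∈ Set.Icc 0 P.T)
    {x : ℝ → Fin nx → ℝ} {u : Fin nu → ℝ}
    (hx : HasDerivWithinAt x (P.A t *ᵥ x t + P.B t *ᵥ u) (Set.Icc 0 P.T) t) :
    ∃ d, HasDerivWithinAt (fun τ => x τ ⬝ᵥ (S τ *ᵥ x τ)) d (Set.Icc 0 P.T) t ∧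
      -(k.lamQ * (x t ⬝ᵥ x t)) -
        k.lamR * (2 * (u ⬝ᵥ u) + 2 * (k.lamH / k.γR) ^ 2 * (x t ⬝ᵥ x t)) ≤ d := by
  refine ⟨_, (isRiccatiSolution_iff.1 hS).1.hasDerivWithinAt_form ht (hS.isSymm hc hb ht) hx, ?_⟩
  -- The input of the reduced system: `A x + B u = F x + B v`.
  set v := u + (P.R t)⁻¹ *ᵥ (P.H t *ᵥ x t) with hv
  have e1 : P.A t *ᵥ x t + P.B t *ᵥ u - P.drift t *ᵥ x t = P.B t *ᵥ v := by
    simp only [drift, hv, Matrix.sub_mulVec, Matrix.mulVec_add, ← Matrix.mulVec_mulVec]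
    abel
  have e2 : (S t *ᵥ x t) ⬝ᵥ (P.B t *ᵥ v) = ((P.B t)ᵀ *ᵥ (S t *ᵥ x t)) ⬝ᵥ v := by
    rw [mulVec_dotProduct_eq (P.B t)ᵀ, Matrix.transpose_transpose]
  have h1 := neg_form_le_completion (hc.symm_R t ht) hc.γR_pos (hc.R_form_le ht) v
    ((P.B t)ᵀ *ᵥ (S t *ᵥ x t))
  have h2 := hc.stateWeight_form_le hb ht (x t)
  have h3 := (abs_le.1 (abs_dotProduct_mulVec_le (hb.norm_R_le t ht) v)).2
  have h4 := add_dotProduct_add_le u ((P.R t)⁻¹ *ᵥ (P.H t *ᵥ x t))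
  have h5 : ((P.R t)⁻¹ *ᵥ (P.H t *ᵥ x t)) ⬝ᵥ ((P.R t)⁻¹ *ᵥ (P.H t *ᵥ x t)) ≤
      (k.lamH / k.γR) ^ 2 * (x t ⬝ᵥ x t) := by
    refine (mulVec_dotProduct_self_le (hc.norm_inv_R_le ht) _).trans ?_
    refine (mul_le_mul_of_nonneg_left (mulVec_dotProduct_self_le (hb.norm_H_le t ht) _)
      (sq_nonneg _)).trans_eq ?_
    ring
  have h6 : v ⬝ᵥ v ≤ 2 * (u ⬝ᵥ u) + 2 * (k.lamH / k.γR) ^ 2 * (x t ⬝ᵥ x t) := by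
    linarith
  have h7 := mul_le_mul_of_nonneg_left h6 hb.lamR_pos.le
  rw [e1, e2, inputWeight_form_eq]
  linarith

/-- Upper bound for `S(t)` away from the terminal time, from a control that steers to the origin. -/
theorem IsRiccatiSolution.form_le_of_steering (hS : P.IsRiccatiSolution S) (hc : P.IsCoercive k)
    (hb : P.IsBounded k) (hu : P.IsUCC k) {t : ℝ} (ht : t ∈ Set.Icc 0 (P.T - k.σ))
    (v : Fin nx → ℝ) :
    v ⬝ᵥ (S t *ᵥ v) ≤
      (k.lamQ * (1 + k.α₁' / k.α₀) ^ 2 * (1 / (2 * k.ω)) * Real.exp (2 * k.ω * k.σ) +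
        k.lamR * (1 / k.α₀')) * (v ⬝ᵥ v) ∧ k.α₀ * (v ⬝ᵥ v) ≤ k.α₁' * (v ⬝ᵥ v) := by
  obtain ⟨t₁, ht₁, hW0, hW1, -, -⟩ := hu.bounds t ht
  have hω := hb.ω_pos hc
  have hA0 := hb.lamA_pos
  have hAω := hb.lamA_le_ω hc
  have hlam := hb.lamQ_pos
  have hR0 := hb.lamR_pos
  have hH0 := hb.lamH_pos
  have hγ := hc.γR_pos
  have hα₀ := hu.α₀_pos
  have hα₁ := hu.α₁_pos
  have hα₁' := hb.α₁'_pos hc hu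
  have hT : t₁ ≤ P.T := ht₁.2.trans (by linarith [ht.2])
  have hσ : t₁ - t ≤ k.σ := by linarith [ht₁.2]
  have hv := dotProduct_self_nonneg' v
  have hI : ∀ τ ∈ Set.Icc t t₁, τ ∈ Set.Icc 0 P.T := fun τ hτ => ⟨ht.1.trans hτ.1, hτ.2.trans hT⟩
  -- A second upper bound for the Gramian of `(A, B)`, from growth alone: `c₁` contains `α₁'` in the
  -- state cost, while `α₁` occurs only inside `α₀'`.
  have hW1' : ∀ z, z ⬝ᵥ (gramian P.A P.B t t₁ *ᵥ z) ≤ k.α₁' * (z ⬝ᵥ z) := fun z => by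
    refine (gramian_form_le hb.continuousOn_A hb.continuousOn_B hω
      (fun τ hτ => (hb.norm_A_le τ hτ).trans hAω) hb.norm_B_le ht.1 ht₁.1 hT z).trans ?_
    refine mul_le_mul_of_nonneg_right ?_ (dotProduct_self_nonneg' z)
    have : Real.exp (2 * k.ω * (t₁ - t)) ≤ Real.exp (2 * k.σ * k.ω) :=
      Real.exp_le_exp.2 (by nlinarith)
    unfold Constants.α₁'
    gcongr
  refine ⟨?_, ((smul_one_le_iff.1 hW0).2 v).trans (hW1' v)⟩
  obtain ⟨x, u, E, hx, hxt, hxt₁, hE, hEt, hEt₁, hgr⟩ := exists_steering hb.continuousOn_A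
    hb.continuousOn_B hb.norm_A_le ht.1 ht₁.1 hT hα₀ (smul_one_le_iff.1 hW0).2 v
  have hg1 := hgr k.α₁ hα₁ (le_smul_one_iff.1 hW1).2
  have hg2 := hgr k.α₁' hα₁' hW1'
  have hd := fun τ (hτ : τ ∈ Set.Icc t t₁) =>
    hS.exists_form_hasDerivWithinAt hc hb (hI τ hτ) (hx τ (hI τ hτ))
  -- `p` measures the state cost, estimated with `α₁'`; `q` measures the part `R⁻¹ H x` of the
  -- reduced input, estimated with `α₁`.
  set p := k.lamQ * ((1 + k.α₁' / k.α₀) ^ 2 * (v ⬝ᵥ v)) with hp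
  set q := (k.lamH / k.γR) ^ 2 * ((1 + k.α₁ / k.α₀) ^ 2 * (v ⬝ᵥ v)) with hq
  have hp0 : 0 ≤ p := by positivity
  have hq0 : 0 ≤ q := by positivity
  have key := le_of_hasDerivWithinAt_nonneg ht.1 ht₁.1 hT
    (f := fun τ => x τ ⬝ᵥ (S τ *ᵥ x τ) + p / (2 * k.ω) * Real.exp (2 * k.ω * (τ - t)) +
      k.lamR * (2 * E τ + q / k.lamA * Real.exp (2 * k.lamA * (τ - t))))
    -- The derivative of `xᵀ S x` is known only through an existential lower bound, so `derivWithin`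
    -- names it; uniqueness of derivatives on `[0, T]` recovers the bound.
    (f' := fun τ => derivWithin (fun τ => x τ ⬝ᵥ (S τ *ᵥ x τ)) (Set.Icc 0 P.T) τ +
      p / (2 * k.ω) * (2 * k.ω * Real.exp (2 * k.ω * (τ - t))) +
      k.lamR * (2 * (u τ ⬝ᵥ u τ) +
        q / k.lamA * (2 * k.lamA * Real.exp (2 * k.lamA * (τ - t)))))
    (fun τ hτ => by
      obtain ⟨d, hd1, -⟩ := hd τ hτ
      exact (hd1.differentiableWithinAt.hasDerivWithinAt.add
        ((hasDerivWithinAt_exp_mul_sub (2 * k.ω) t).const_mul _)).add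
        ((((hE τ (hI τ hτ)).const_mul 2).add
          ((hasDerivWithinAt_exp_mul_sub (2 * k.lamA) t).const_mul _)).const_mul _))
    (fun τ hτ => by
      obtain ⟨d, hd1, hd2⟩ := hd τ hτ
      rw [hd1.derivWithin (uniqueDiffOn_Icc (hu.σ_pos.trans hu.σ_lt) τ (hI τ hτ))]
      have h1 : p / (2 * k.ω) * (2 * k.ω * Real.exp (2 * k.ω * (τ - t))) =
        p * Real.exp (2 * k.ω * (τ - t)) := by field_simp
      have h2 : q / k.lamA * (2 * k.lamA * Real.exp (2 * k.lamA * (τ - t))) =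
        2 * (q * Real.exp (2 * k.lamA * (τ - t))) := by field_simp
      have h3 : Real.exp (2 * k.lamA * (τ - t)) ≤ Real.exp (2 * k.ω * (τ - t)) :=
        Real.exp_le_exp.2 (by nlinarith [hτ.1])
      have h4 : k.lamQ * (x τ ⬝ᵥ x τ) ≤ p * Real.exp (2 * k.ω * (τ - t)) := by
        refine (mul_le_mul_of_nonneg_left (hg2 τ hτ) hlam.le).trans ?_
        refine le_trans (le_of_eq ?_) (mul_le_mul_of_nonneg_left h3 hp0)
        rw [hp]
        ring
      have h5 : (k.lamH / k.γR) ^ 2 * (x τ ⬝ᵥ x τ) ≤ q * Real.exp (2 * k.lamA * (τ - t)) := by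
        refine (mul_le_mul_of_nonneg_left (hg1 τ hτ) (sq_nonneg _)).trans_eq ?_
        rw [hq]
        ring
      have h6 := mul_le_mul_of_nonneg_left h5 hR0.le
      rw [h1, h2]
      linarith)
  simp only [hxt, hxt₁, hEt, sub_self, mul_zero, Real.exp_zero, mul_one, Matrix.mulVec_zero,
    dotProduct_zero, zero_add] at key
  have e1 : Real.exp (2 * k.ω * (t₁ - t)) ≤ Real.exp (2 * k.ω * k.σ) :=
    Real.exp_le_exp.2 (by nlinarith)
  have e2 : Real.exp (2 * k.lamA * (t₁ - t)) ≤ Real.exp (2 * k.lamA * k.σ) :=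
    Real.exp_le_exp.2 (by nlinarith)
  have m1 := mul_le_mul_of_nonneg_left e1 (div_nonneg hp0 (by positivity : 0 ≤ 2 * k.ω))
  have m2 := mul_le_mul_of_nonneg_left e2 (div_nonneg hq0 hA0.le)
  have m3 : 0 ≤ p / (2 * k.ω) := by positivity
  have m4 := mul_le_mul_of_nonneg_left
    (add_le_add (mul_le_mul_of_nonneg_left hEt₁ zero_le_two) m2) hR0.le
  -- The energy `2 / α₀` and the integral of the `q` term add up exactly to `1 / α₀'`.
  have e3 : (k.lamQ * (1 + k.α₁' / k.α₀) ^ 2 * (1 / (2 * k.ω)) * Real.exp (2 * k.ω * k.σ) +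
      k.lamR * (1 / k.α₀')) * (v ⬝ᵥ v) = p / (2 * k.ω) * Real.exp (2 * k.ω * k.σ) +
      k.lamR * (2 * (1 / k.α₀ * (v ⬝ᵥ v)) + q / k.lamA * Real.exp (2 * k.lamA * k.σ)) -
      k.lamR * (q / k.lamA) := by
    rw [hp, hq, Constants.α₀', one_div (_⁻¹), inv_inv]
    ring
  rw [e3]
  linarith

/-- The two regimes meet at `T - σ` and match the two entries of the maximum in `c₁`. In the
steering regime `α₀' ≤ α₀ ≤ α₁' ≤ λ_B² e^{2ωσ} / (2ω)` converts the constants obtained into those of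
`c₁`. -/
theorem IsRiccatiSolution.form_le_c₁ (hS : P.IsRiccatiSolution S) (hc : P.IsCoercive k)
    (hb : P.IsBounded k) (hu : P.IsUCC k) {t : ℝ} (ht : t ∈ Set.Icc 0 P.T) (v : Fin nx → ℝ) :
    v ⬝ᵥ (S t *ᵥ v) ≤ k.c₁ * (v ⬝ᵥ v) := by
  have hω := hb.ω_pos hc
  have hA0 := hb.lamA_pos
  have hB0 := hb.lamB_pos
  have hQ0 := hb.lamQ_pos
  have hR0 := hb.lamR_pos
  have hH0 := hb.lamH_pos
  have hγ := hc.γR_pos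
  have hσ := hu.σ_pos
  have hα₀ := hu.α₀_pos
  have hα₁ := hu.α₁_pos
  have hα₁' := hb.α₁'_pos hc hu
  have hv := dotProduct_self_nonneg' v
  have hQ1 : k.lamQ ≤ k.lamQ + k.lamH ^ 2 / k.γR := le_add_of_nonneg_right (by positivity)
  rcases le_total t (P.T - k.σ) with h | h
  · obtain ⟨h1, h2⟩ := hS.form_le_of_steering hc hb hu ⟨ht.1, h⟩ v
    -- `α₀ ≤ α₁'` can be read off only from a nonzero vector; in dimension `0` there is none.
    rcases hv.eq_or_lt with h0 | h0
    · rw [← h0] at h1 ⊢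
      simpa using h1
    have hα : k.α₀ ≤ k.α₁' := le_of_mul_le_mul_right h2 h0
    refine h1.trans (mul_le_mul_of_nonneg_right ?_ hv)
    have hα₀' : 0 < k.α₀' ∧ k.α₀' ≤ k.α₀ := by
      have e1 : 0 ≤ Real.exp (2 * k.lamA * k.σ) - 1 :=
        sub_nonneg.2 (Real.one_le_exp (by positivity))
      have e2 : 0 ≤ (k.lamH / k.γR) ^ 2 / k.lamA * (1 + k.α₁ / k.α₀) ^ 2 *
        (Real.exp (2 * k.lamA * k.σ) - 1) := by positivity
      unfold Constants.α₀'
      refine ⟨by positivity, inv_le_of_inv_le₀ hα₀ ?_⟩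
      have : k.α₀⁻¹ ≤ 2 / k.α₀ := by
        rw [← one_div]
        gcongr
        norm_num
      linarith
    obtain ⟨hα₀', hle⟩ := hα₀'
    have hα₁'_le : k.α₁' ≤ k.lamB ^ 2 * (1 / (2 * k.ω)) * Real.exp (2 * k.ω * k.σ) := by
      have : Real.exp (2 * k.σ * k.ω) = Real.exp (2 * k.ω * k.σ) := by ring_nf
      rw [Constants.α₁', this, mul_one_div, div_mul_eq_mul_div]
      gcongr
      linarith
    have m1 : k.lamQ * (1 + k.α₁' / k.α₀) ^ 2 ≤
        (k.lamQ + k.lamH ^ 2 / k.γR) * (1 + k.α₁' / k.α₀') ^ 2 := by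
      gcongr
    have m2 : k.lamR * (1 / k.α₀') ≤ k.lamR * k.lamB ^ 2 / k.α₀' ^ 2 * (1 / (2 * k.ω)) *
        Real.exp (2 * k.ω * k.σ) := by
      have e : k.lamR * (1 / k.α₀') = k.lamR / k.α₀' ^ 2 * k.α₀' := by field_simp
      rw [e]
      refine (mul_le_mul_of_nonneg_left ((hle.trans hα).trans hα₁'_le)
        (by positivity)).trans_eq ?_
      ring
    have m3 := mul_le_mul_of_nonneg_right m1
      (by positivity : 0 ≤ 1 / (2 * k.ω) * Real.exp (2 * k.ω * k.σ))
    refine le_trans ?_ (mul_le_mul_of_nonneg_right (le_max_left _ _) (Real.exp_pos _).le)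
    linarith
  · refine (hS.form_le_of_free hc hb ht v).trans (mul_le_mul_of_nonneg_right ?_ hv)
    refine le_trans ?_ (mul_le_mul_of_nonneg_right (le_max_right _ _) (Real.exp_pos _).le)
    have : P.T - t ≤ k.σ := by linarith
    gcongr

end Problem

end LQControl
theorem mainTheorem6 (nx nu : ℕ) (k : LQControl.Constants) (P : LQControl.Problem nx nu)
    (hbdd : P.IsBounded k) (hucc : P.IsUCC k) (hcoer : P.IsCoercive k) :
    ∃ S : ℝ → Matrix (Fin nx) (Fin nx) ℝ,
      P.IsRiccatiSolution S ∧
      (∀ S' : ℝ → Matrix (Fin nx) (Fin nx) ℝ,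
        P.IsRiccatiSolution S' → Set.EqOn S' S (Set.Icc 0 P.T)) ∧
      ∀ t₀ t₁ : ℝ, 0 ≤ t₀ → t₀ ≤ t₁ → t₁ ≤ P.T →
        ‖LQControl.evolutionOperator (P.closedLoop S) t₁ t₀‖ ≤
          Real.sqrt (k.c₁ / k.c₀) * Real.exp (-(k.γQ / (2 * k.c₁)) * (t₁ - t₀)) := by
  obtain ⟨S, hS⟩ := hcoer.exists_isRiccatiSolution hbdd (hucc.σ_pos.trans hucc.σ_lt).le
  refine ⟨S, hS, fun S' hS' => hS.eqOn hcoer hbdd hS', fun t₀ t₁ h0 h01 h1 => ?_⟩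
  rw [LQControl.Problem.closedLoop_eq]
  exact (LQControl.Problem.isRiccatiSolution_iff.1 hS).1.closedLoop_norm_le
    (hcoer.drift_continuousOn hbdd) (hcoer.inputWeight_continuousOn hbdd)
    (fun _ h => hS.isSymm hcoer hbdd h) (fun _ h x => hcoer.inputWeight_form_nonneg h x)
    hcoer.γQ_pos.le (hbdd.c₀_bounds hcoer hucc).1 (hbdd.c₁_pos hcoer)
    (fun _ h x => hcoer.le_stateWeight_form h x)
    (fun _ h x => hS.c₀_le_form hcoer hbdd hucc h x)
    (fun _ h x => hS.form_le_c₁ hcoer hbdd hucc h x) h0 h01 h1
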